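/- Let $a\in(0,1/14)$, let $(\Omega,\mathcal F,\mathbb P)$ be a probability space, and let $(X_n)_{n\ge 1}$ be independent random variables on it with $\mathbb P(X_n=1)=n^{-a}$ and $\mathbb P(X_n=0)=1-n^{-a}$ for every $n\ge 1$. For $\omega\in\Omega$ let $a_1(\omega)<a_2(\omega)<\cdots$ be the positive integers $k$ with $X_k(\omega)=1$, listed in increasing order. Then almost surely there are infinitely many such integers, so that $(a_n(\omega))_{n\ge1}$ is an infinite sequence, and the following holds (the set of $\omega$ of probability $1$ does not depend on any of the objects below). For every probability space $(X,\mathcal X,\mu)$, all measure preserving transformations $T,S\colon X\to X$ with $TS=ST$, and all (complex-valued) $f,g\in L^\infty(\mu)$, for $\mu$-almost every $x\in X$, $$\lim_{N\to\infty}\frac1N\sum_{n=1}^N f(T^nx)\cdot g(S^{a_n(\omega)}x)=\tilde f(x)\cdot\tilde g(x),$$ where $$\tilde f(x)=\lim_{N\to\infty}\frac1N\sum_{n=1}^N f(T^nx)=\mathbb E(f\mid\mathcal I(T))(x),\qquad \tilde g(x)=\lim_{N\to\infty}\frac1N\sum_{n=1}^N g(S^nx)=\mathbb E(g\mid\mathcal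 I(S))(x),$$ these limits existing for $\mu$-almost every $x$. Here $\mathcal I(T)=\{A\in\mathcal X: T^{-1}A=A\}$, $\mathcal I(S)=\{A\in\mathcal X: S^{-1}A=A\}$, and $\mathbb E(\,\cdot\mid\mathcal Y)$ is the conditional expectation with respect to $\mu$ given the sub-$\sigma$-algebra $\mathcal Y$. -/

import Mathlib

open MeasureTheory ProbabilityTheory Filter Topology

universe u v

/-- The positive integers `k` with `X k ω = 1`, i.e. the integers selected at `ω`
(the value of `X` at the index `0` plays no role). -/
def selected {Ω : Type u} (X : ℕ → Ω → ℝ) (ω : Ω) : Set ℕ :=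
  {k | 1 ≤ k ∧ X k ω = 1}

/-- `randomSeq X ω n`, for `n ≥ 1`, is the `n`-th selected integer in increasing order:
`randomSeq X ω 1 < randomSeq X ω 2 < ⋯` enumerates `selected X ω` when this set is infinite.
(`Nat.nth` counts from `0`, hence the shift.) -/
noncomputable def randomSeq {Ω : Type u} (X : ℕ → Ω → ℝ) (ω : Ω) (n : ℕ) : ℕ :=
  Nat.nth (fun k => k ∈ selected X ω) (n - 1)

/-! Write `b k` for the indicator that `k + 1` is selected, `τ k` for its probability, `W N` for the
sum of the first `N` probabilities and `s = partialCount b`. Up to shifts by one, the average over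
`n ≤ s N` is the sum over `k < N` of `b k * f (T^[s k] x) * g (S^[k] x)`, divided by `s N`; moreover
`s N / W N → 1`. Two facts give the limit.

(1) The weight `b` may be replaced by `τ`. With `y = b - τ`, van der Corput's inequality bounds the
mean square of the sum by correlations of shifts `h' < h`. Sorting these by `l = s (p + h) - s (p +
h')` and using the invariance of the measure, the factor coming from `f` is made independent of `p`
(`norm_sum_correlation_le`). What is left is controlled, by transference to a finite group and
Plancherel, by exponential sums in `y` and `s` alone. Since `y (p + h)` is independent of everything
earlier, these are martingale sums, and an Azuma bound with Borel–Cantelli controls them almost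
surely (`ae_eventually_correlationBound`). No dynamical system enters these sums, so the exceptional
set of `ω` is universal. The mean squares are summable along `N = j ^ 48`, and monotonicity of the
weights fills in the other `N`.

(2) In the sum weighted by `τ`, the factor `f (T^[s k] x)` changes only at selected `k`, which are
sparse. Hence `g (S^[k] x)` may be replaced by its average over many consecutive times, and so by
its conditional expectation (`tendsto_sum_mul_of_short_averages`, `ae_exists_short_average`). The
remaining average of `τ k * f (T^[s k] x)` is, by (1) with `g = 1`, asymptotically a Birkhoff
average of `f`. -/

/-! ### Plancherel on finite groups and transference to commuting maps -/

theorem sum_addChar_normSq {A : Type*} [AddCommGroup A] [Fintype A] (K : A → ℂ) :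
    ∑ ψ : AddChar A ℂ, ‖∑ x, K x * ψ x‖ ^ 2 = (Fintype.card A : ℝ) * ∑ x, ‖K x‖ ^ 2 := by
  classical
  apply Complex.ofReal_injective
  push_cast
  simp_rw [← Complex.mul_conj', map_sum, Finset.sum_mul_sum, map_mul, ← AddChar.map_neg_eq_conj]
  rw [Finset.sum_comm]
  simp_rw [Finset.sum_comm (s := (Finset.univ : Finset (AddChar A ℂ)))]
  have h : ∀ x y : A, ∑ ψ : AddChar A ℂ, K x * ψ x * ((starRingEnd ℂ) (K y) * ψ (-y))
      = K x * (starRingEnd ℂ) (K y) * if x = y then (Fintype.card A : ℂ) else 0 := by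
    intro x y
    have := AddChar.sum_apply_eq_ite (x - y)
    simp only [sub_eq_zero] at this
    rw [← this, Finset.mul_sum]
    refine Finset.sum_congr rfl fun ψ _ => ?_
    rw [sub_eq_add_neg, AddChar.map_add_eq_mul]
    ring
  simp_rw [h]
  simp [Finset.mul_sum, mul_comm]

/-- The inner sum is a convolution, which the Fourier transform turns into multiplication by a
factor of size at most `B`; Plancherel is applied on both sides. -/
theorem sum_normSq_translates_le {A ι : Type*} [AddCommGroup A] [Fintype A] (s : Finset ι)
    (w : ι → ℂ) (γ : ι → A) {B : ℝ} (hB : ∀ ψ : AddChar A ℂ, ‖∑ p ∈ s, w p * ψ (γ p)‖ ≤ B)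
    (H : A → ℂ) :
    ∑ x, ‖∑ p ∈ s, w p * H (x + γ p)‖ ^ 2 ≤ B ^ 2 * ∑ x, ‖H x‖ ^ 2 := by
  have hc : (0 : ℝ) < Fintype.card A := by exact_mod_cast Fintype.card_pos
  have key : ∀ ψ : AddChar A ℂ, ∑ x, (∑ p ∈ s, w p * H (x + γ p)) * ψ x
      = (∑ p ∈ s, w p * (-ψ) (γ p)) * ∑ x, H x * ψ x := by
    intro ψ
    simp_rw [Finset.sum_mul]
    rw [Finset.sum_comm]
    refine Finset.sum_congr rfl fun p _ => ?_
    rw [← Equiv.sum_comp (Equiv.addRight (γ p)) (fun x => H x * ψ x), Finset.mul_sum]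
    refine Finset.sum_congr rfl fun x _ => ?_
    simp only [Equiv.coe_addRight, AddChar.map_add_eq_mul, AddChar.neg_apply]
    have : ψ (-γ p) * ψ (γ p) = 1 := by rw [← AddChar.map_add_eq_mul]; simp
    linear_combination (- w p * H (x + γ p) * ψ x) * this
  have h1 := sum_addChar_normSq (fun x => ∑ p ∈ s, w p * H (x + γ p))
  have h2 := sum_addChar_normSq H
  refine le_of_mul_le_mul_left ?_ hc
  rw [← h1, mul_left_comm, ← h2, Finset.mul_sum]
  refine Finset.sum_le_sum fun ψ _ => ?_
  rw [key, norm_mul, mul_pow]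
  gcongr
  exact hB _

/-- Calderón transference. The integral is unchanged by the `D ^ 2` shifts `S^[u] T^[v]`, and for
fixed `x` the shifted sums are sums of translates on a finite group. The modulus `2 * D` prevents
wrap-around; the factor `4` is the ratio of the order of the group to the number of shifts. -/
theorem integral_normSq_sum_le_of_addChar {Y : Type*} [MeasurableSpace Y] {μ : Measure Y}
    [IsProbabilityMeasure μ] {T S : Y → Y} (hT : MeasurePreserving T μ μ)
    (hS : MeasurePreserving S μ μ) (hTS : Function.Commute T S) {G : Y → ℂ} (hG : Measurable G)
    (hG1 : ∀ x, ‖G x‖ ≤ 1) {ι : Type*} (s : Finset ι) (w : ι → ℂ) (e₁ e₂ : ι → ℕ) (D : ℕ)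
    [NeZero (2 * D)] (h₁ : ∀ p ∈ s, e₁ p < D) (h₂ : ∀ p ∈ s, e₂ p < D) {B : ℝ}
    (hB : ∀ ψ : AddChar (ZMod (2 * D) × ZMod (2 * D)) ℂ,
      ‖∑ p ∈ s, w p * ψ ((e₁ p : ZMod (2 * D)), (e₂ p : ZMod (2 * D)))‖ ≤ B) :
    ∫ x, ‖∑ p ∈ s, w p * G (S^[e₁ p] (T^[e₂ p] x))‖ ^ 2 ∂μ ≤ 4 * B ^ 2 := by
  have hD : 0 < D := by have := NeZero.pos (2 * D); omega
  set Φ : Y → ℝ := fun x => ‖∑ p ∈ s, w p * G (S^[e₁ p] (T^[e₂ p] x))‖ ^ 2 with hΦ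
  have hm : ∀ i j, Measurable fun x => G (S^[i] (T^[j] x)) := fun i j =>
    hG.comp ((hS.measurable.iterate i).comp (hT.measurable.iterate j))
  have hΦm : Measurable Φ :=
    ((Finset.measurable_fun_sum s fun p _ => (hm _ _).const_mul (w p)).norm.pow_const 2)
  have hΦb : ∀ x, ‖Φ x‖ ≤ (∑ p ∈ s, ‖w p‖) ^ 2 := by
    intro x
    rw [Real.norm_of_nonneg (by positivity)]
    refine pow_le_pow_left₀ (norm_nonneg _) ((norm_sum_le _ _).trans ?_) 2
    refine Finset.sum_le_sum fun p _ => ?_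
    rw [norm_mul]
    exact mul_le_of_le_one_right (norm_nonneg _) (hG1 _)
  have hshift : ∀ u v, ∫ x, Φ (S^[u] (T^[v] x)) ∂μ = ∫ x, Φ x ∂μ := by
    intro u v
    have hp : MeasurePreserving (fun x => S^[u] (T^[v] x)) μ μ :=
      (hS.iterate u).comp (hT.iterate v)
    rw [← hp.map_eq, integral_map hp.measurable.aemeasurable hΦm.aestronglyMeasurable, hp.map_eq]
  have hpt : ∀ x, ∑ u ∈ Finset.range D, ∑ v ∈ Finset.range D, Φ (S^[u] (T^[v] x))
      ≤ B ^ 2 * (4 * D ^ 2) := by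
    intro x
    have h := sum_normSq_translates_le s w
      (fun p => ((e₁ p : ZMod (2 * D)), (e₂ p : ZMod (2 * D)))) hB
      (fun z => G (S^[z.1.val] (T^[z.2.val] x)))
    have hr : ∑ z : ZMod (2 * D) × ZMod (2 * D), ‖G (S^[z.1.val] (T^[z.2.val] x))‖ ^ 2
        ≤ 4 * D ^ 2 := by
      calc _ ≤ ∑ z : ZMod (2 * D) × ZMod (2 * D), (1 : ℝ) :=
            Finset.sum_le_sum fun z _ => pow_le_one₀ (norm_nonneg _) (hG1 _)
        _ = 4 * D ^ 2 := by
            simp only [Finset.sum_const, Finset.card_univ, Fintype.card_prod, ZMod.card]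
            simp; ring
    refine le_trans ?_ (h.trans (mul_le_mul_of_nonneg_left hr (sq_nonneg B)))
    rw [← Finset.sum_product']
    have hinj : Set.InjOn (fun q : ℕ × ℕ => ((q.1 : ZMod (2 * D)), (q.2 : ZMod (2 * D))))
        (Finset.range D ×ˢ Finset.range D : Finset (ℕ × ℕ)) := by
      rintro ⟨i, j⟩ hij ⟨i', j'⟩ hij' he
      simp only [Finset.coe_product, Finset.coe_range, Set.mem_prod, Set.mem_Iio] at hij hij'
      simp only [Prod.mk.injEq] at he ⊢
      have e1 := congrArg ZMod.val he.1
      have e2 := congrArg ZMod.val he.2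
      rw [ZMod.val_natCast_of_lt (by omega), ZMod.val_natCast_of_lt (by omega)] at e1 e2
      exact ⟨e1, e2⟩
    classical
    -- The shifts form a box in the group; the points outside it only add nonnegative terms.
    refine le_trans (le_of_eq ?_) (Finset.sum_le_sum_of_subset_of_nonneg
      (Finset.subset_univ ((Finset.range D ×ˢ Finset.range D).image
        (fun q : ℕ × ℕ => ((q.1 : ZMod (2 * D)), (q.2 : ZMod (2 * D))))))
      fun _ _ _ => sq_nonneg _)
    rw [Finset.sum_image hinj]
    refine Finset.sum_congr rfl fun q hq => ?_
    simp only [Finset.mem_product, Finset.mem_range] at hq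
    simp only [hΦ]
    congr 2
    refine Finset.sum_congr rfl fun p hp => ?_
    have := h₁ p hp
    have := h₂ p hp
    simp only [Prod.mk_add_mk, ← Nat.cast_add]
    rw [ZMod.val_natCast_of_lt (by omega), ZMod.val_natCast_of_lt (by omega), add_comm q.1,
      add_comm q.2, Function.iterate_add_apply, Function.iterate_add_apply,
      ((hTS.iterate_iterate (e₂ p) q.1) _).symm]
  have hint : ∀ u v, Integrable (fun x => Φ (S^[u] (T^[v] x))) μ := fun u v =>
    Integrable.of_bound (hΦm.comp
      ((hS.measurable.iterate u).comp (hT.measurable.iterate v))).aestronglyMeasurable _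
      (Eventually.of_forall fun x => hΦb _)
  have hI := integral_mono (μ := μ)
    (integrable_finsetSum (Finset.range D) fun u _ =>
      integrable_finsetSum (Finset.range D) fun v _ => hint u v)
    (integrable_const (B ^ 2 * (4 * (D : ℝ) ^ 2))) hpt
  rw [integral_finsetSum _ fun u _ => integrable_finsetSum _ fun v _ => hint u v] at hI
  simp_rw [integral_finsetSum _ fun v (_ : v ∈ Finset.range D) => hint _ v, hshift] at hI
  simp only [Finset.sum_const, Finset.card_range, nsmul_eq_mul, integral_const, probReal_univ,
    smul_eq_mul, one_mul] at hI
  have hD' : (0 : ℝ) < D := by exact_mod_cast hD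
  have : (D : ℝ) ^ 2 * ∫ x, Φ x ∂μ ≤ (D : ℝ) ^ 2 * (4 * B ^ 2) := by nlinarith
  exact le_of_mul_le_mul_left this (by positivity)

/-! ### Van der Corput's inequality -/

theorem norm_sum_range_sub_sum_range_add_le (v : ℕ → ℂ) (hv : ∀ n, ‖v n‖ ≤ 1) (N h : ℕ) :
    ‖∑ p ∈ Finset.range N, v p - ∑ p ∈ Finset.range N, v (p + h)‖ ≤ 2 * h := by
  induction h with
  | zero => simp
  | succ h ih =>
    have e : ∑ p ∈ Finset.range N, v (p + h) - ∑ p ∈ Finset.range N, v (p + (h + 1))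
        = v h - v (N + h) := by
      have := Finset.sum_range_sub' (fun p => v (p + h)) N
      rw [Finset.sum_sub_distrib] at this
      simpa [add_assoc, add_comm 1 h] using this
    have := hv h
    have := hv (N + h)
    calc _ = ‖(∑ p ∈ Finset.range N, v p - ∑ p ∈ Finset.range N, v (p + h))
            + (v h - v (N + h))‖ := by rw [← e]; congr 1; ring
      _ ≤ 2 * h + (1 + 1) := (norm_add_le _ _).trans
          (add_le_add ih ((norm_sub_le _ _).trans (by linarith)))
      _ = _ := by push_cast; ring

/-- Replacing `M` copies of the sum by its shifts by `h < M` costs at most `2 * h` each, so at most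
`2 * M ^ 2`; Cauchy–Schwarz in `p` handles the shifted double sum `U`. -/
theorem vanDerCorput_normSq (v : ℕ → ℂ) (hv : ∀ n, ‖v n‖ ≤ 1) (N M : ℕ) :
    (M : ℝ) ^ 2 * ‖∑ p ∈ Finset.range N, v p‖ ^ 2 ≤ 8 * (M : ℝ) ^ 4
      + 2 * N * ∑ p ∈ Finset.range N, ‖∑ h ∈ Finset.range M, v (p + h)‖ ^ 2 := by
  set U := ∑ p ∈ Finset.range N, ∑ h ∈ Finset.range M, v (p + h) with hU
  have h1 : ‖(M : ℂ) * ∑ p ∈ Finset.range N, v p - U‖ ≤ 2 * (M : ℝ) ^ 2 := by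
    have : (M : ℂ) * ∑ p ∈ Finset.range N, v p - U
        = ∑ h ∈ Finset.range M, (∑ p ∈ Finset.range N, v p - ∑ p ∈ Finset.range N, v (p + h)) := by
      rw [hU, Finset.sum_comm, Finset.sum_sub_distrib]; simp
    rw [this]
    refine (norm_sum_le _ _).trans ?_
    calc _ ≤ ∑ h ∈ Finset.range M, 2 * (M : ℝ) := Finset.sum_le_sum fun h hh => by
          refine (norm_sum_range_sub_sum_range_add_le v hv N h).trans ?_
          have : (h : ℝ) ≤ M := by exact_mod_cast (Finset.mem_range.1 hh).le
          linarith
      _ = _ := by simp; ring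
  have h2 : ‖U‖ ^ 2 ≤ N * ∑ p ∈ Finset.range N, ‖∑ h ∈ Finset.range M, v (p + h)‖ ^ 2 := by
    have := sq_sum_le_card_mul_sum_sq (s := Finset.range N)
      (f := fun p => ‖∑ h ∈ Finset.range M, v (p + h)‖)
    rw [Finset.card_range] at this
    exact (pow_le_pow_left₀ (norm_nonneg _) (norm_sum_le _ _) 2).trans this
  have h3 : (M : ℝ) * ‖∑ p ∈ Finset.range N, v p‖ ≤ 2 * (M : ℝ) ^ 2 + ‖U‖ := by
    have : ‖(M : ℂ) * ∑ p ∈ Finset.range N, v p‖ ≤ _ :=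
      norm_le_norm_sub_add ((M : ℂ) * ∑ p ∈ Finset.range N, v p) U
    rw [norm_mul, Complex.norm_natCast] at this
    linarith
  have h4 := pow_le_pow_left₀ (by positivity) h3 2
  nlinarith [sq_nonneg (2 * (M : ℝ) ^ 2 - ‖U‖)]

/-- Expanding the inner square, each of the `M` diagonal terms is at most `N`; the others are
covered by `hC`, after conjugation when `h < h'`. -/
theorem integral_normSq_sum_le_of_correlations {Y : Type*} [MeasurableSpace Y] {μ : Measure Y}
    [IsProbabilityMeasure μ] {v : ℕ → Y → ℂ} (hm : ∀ n, Measurable (v n))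
    (hv : ∀ n x, ‖v n x‖ ≤ 1) (N M : ℕ) {C : ℝ} (hC0 : 0 ≤ C)
    (hC : ∀ h' h, h' < h → h < M →
      ‖∑ p ∈ Finset.range N, ∫ x, v (p + h) x * (starRingEnd ℂ) (v (p + h') x) ∂μ‖ ≤ C) :
    (M : ℝ) ^ 2 * ∫ x, ‖∑ p ∈ Finset.range N, v p x‖ ^ 2 ∂μ
      ≤ 8 * (M : ℝ) ^ 4 + 2 * N * (M * N + (M : ℝ) ^ 2 * C) := by
  have hmul : ∀ i j, Integrable (fun x => v i x * (starRingEnd ℂ) (v j x)) μ := fun i j =>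
    Integrable.of_bound ((hm i).mul
      (Complex.continuous_conj.measurable.comp (hm j))).aestronglyMeasurable 1
      (Eventually.of_forall fun x => by
        rw [norm_mul, RCLike.norm_conj]
        exact mul_le_one₀ (hv _ _) (norm_nonneg _) (hv _ _))
  have hsqm : ∀ (s : Finset ℕ) (k : ℕ), Integrable (fun x => ‖∑ p ∈ s, v (k + p) x‖ ^ 2) μ :=
    fun s k => Integrable.of_bound
      ((Finset.measurable_fun_sum s fun p _ => hm _).norm.pow_const 2).aestronglyMeasurable
      ((s.card : ℝ) ^ 2) (Eventually.of_forall fun x => by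
        rw [Real.norm_of_nonneg (by positivity)]
        refine pow_le_pow_left₀ (norm_nonneg _) ((norm_sum_le _ _).trans ?_) 2
        simpa using Finset.sum_le_sum fun p (_ : p ∈ s) => hv (k + p) x)
  have hstep : ∑ p ∈ Finset.range N, ∫ x, ‖∑ h ∈ Finset.range M, v (p + h) x‖ ^ 2 ∂μ
      ≤ M * N + (M : ℝ) ^ 2 * C := by
    have e : ((∑ p ∈ Finset.range N, ∫ x, ‖∑ h ∈ Finset.range M, v (p + h) x‖ ^ 2 ∂μ : ℝ) : ℂ)
        = ∑ h ∈ Finset.range M, ∑ h' ∈ Finset.range M, ∑ p ∈ Finset.range N,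
          ∫ x, v (p + h) x * (starRingEnd ℂ) (v (p + h') x) ∂μ := by
      push_cast
      calc _ = ∑ p ∈ Finset.range N, ∑ h ∈ Finset.range M, ∑ h' ∈ Finset.range M,
              ∫ x, v (p + h) x * (starRingEnd ℂ) (v (p + h') x) ∂μ := by
            refine Finset.sum_congr rfl fun p _ => ?_
            rw [← integral_complex_ofReal]
            simp_rw [← integral_finsetSum _ fun h' (_ : h' ∈ Finset.range M) => hmul _ (p + h')]
            rw [← integral_finsetSum _ fun h _ => integrable_finsetSum _ fun h' _ => hmul _ _]
            refine integral_congr_ae (Eventually.of_forall fun x => ?_)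
            simp only
            push_cast
            rw [← Complex.mul_conj', map_sum, Finset.sum_mul_sum]
        _ = _ := by
            rw [Finset.sum_comm]
            refine Finset.sum_congr rfl fun p _ => ?_
            rw [Finset.sum_comm]
    have hle := (Complex.re_le_norm _).trans (norm_sum_le (Finset.range M) fun h =>
      ∑ h' ∈ Finset.range M, ∑ p ∈ Finset.range N,
          ∫ x, v (p + h) x * (starRingEnd ℂ) (v (p + h') x) ∂μ)
    rw [← e, Complex.ofReal_re] at hle
    refine hle.trans ?_
    have hone : ∀ h ∈ Finset.range M, ∀ h' ∈ Finset.range M, ‖∑ p ∈ Finset.range N,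
          ∫ x, v (p + h) x * (starRingEnd ℂ) (v (p + h') x) ∂μ‖
          ≤ (if h = h' then (N : ℝ) else 0) + C := by
      intro h hh h' hh'
      rcases lt_trichotomy h h' with hlt | heq | hgt
      · rw [if_neg hlt.ne, zero_add]
        refine le_trans (le_of_eq ?_) (hC h h' hlt (Finset.mem_range.1 hh'))
        rw [← RCLike.norm_conj, map_sum]
        congr 1
        refine Finset.sum_congr rfl fun p _ => ?_
        rw [← integral_conj]
        simp [mul_comm]
      · subst heq
        rw [if_pos rfl]
        refine ((norm_sum_le _ _).trans ?_).trans (le_add_of_nonneg_right hC0)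
        calc _ ≤ ∑ p ∈ Finset.range N, (1 : ℝ) := Finset.sum_le_sum fun p _ => by
              have := norm_integral_le_of_norm_le_const (μ := μ) (C := 1)
                (f := fun x => v (p + h) x * (starRingEnd ℂ) (v (p + h) x))
                (Eventually.of_forall fun x => by
                  rw [norm_mul, RCLike.norm_conj]
                  exact mul_le_one₀ (hv _ _) (norm_nonneg _) (hv _ _))
              simpa using this
          _ = N := by simp
      · rw [if_neg hgt.ne', zero_add]
        exact hC h' h hgt (Finset.mem_range.1 hh)
    calc _ ≤ ∑ h ∈ Finset.range M, ∑ h' ∈ Finset.range M,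
            ((if h = h' then (N : ℝ) else 0) + C) :=
          Finset.sum_le_sum fun h hh => (norm_sum_le _ _).trans
            (Finset.sum_le_sum fun h' hh' => hone h hh h' hh')
      _ = M * N + (M : ℝ) ^ 2 * C := by
          simp only [Finset.sum_add_distrib, Finset.sum_ite_eq, Finset.mem_range]
          rw [Finset.sum_congr rfl fun h hh => if_pos (Finset.mem_range.1 hh)]
          simp; ring
  have hI := integral_mono (μ := μ) (((hsqm (Finset.range N) 0).const_mul _))
    ((integrable_const _).add ((integrable_finsetSum (Finset.range N)
      fun p _ => hsqm (Finset.range M) p).const_mul _))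
    (fun x => by simpa using vanDerCorput_normSq (fun n => v n x) (fun n => hv n x) N M)
  simp only [zero_add, Pi.add_apply] at hI
  rw [integral_const_mul, integral_add (integrable_const _)
    ((integrable_finsetSum (Finset.range N) fun p _ => hsqm (Finset.range M) p).const_mul _),
    integral_const_mul, integral_const_mul,
    integral_finsetSum _ fun p _ => hsqm (Finset.range M) p] at hI
  simp only [integral_const, probReal_univ, smul_eq_mul, one_mul] at hI
  exact hI.trans (by gcongr)

/-! ### Reduction of correlations to exponential sums -/

/-- The partial sums of a sequence of natural numbers. -/
def partialCount (b : ℕ → ℕ) (n : ℕ) : ℕ := ∑ i ∈ Finset.range n, b i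

theorem partialCount_succ (b : ℕ → ℕ) (n : ℕ) :
    partialCount b (n + 1) = partialCount b n + b n := Finset.sum_range_succ _ _

theorem partialCount_mono (b : ℕ → ℕ) : Monotone (partialCount b) :=
  monotone_nat_of_le_succ fun n => by rw [partialCount_succ]; omega

theorem partialCount_add_le {b : ℕ → ℕ} (hb : ∀ n, b n ≤ 1) (m n : ℕ) :
    partialCount b (m + n) ≤ partialCount b m + n := by
  induction n with
  | zero => simp
  | succ n ih =>
    rw [← add_assoc, partialCount_succ]
    have := hb (m + n)
    omega

theorem partialCount_le {b : ℕ → ℕ} (hb : ∀ n, b n ≤ 1) (n : ℕ) : partialCount b n ≤ n := by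
  have := partialCount_add_le hb 0 n
  simpa [partialCount] using this

/-- The weights `y (p + h) y (p + h')`, restricted to those `p` for which the partial counts
at `p + h` and `p + h'` differ by `l`. -/
noncomputable def correlationWeight (b : ℕ → ℕ) (y : ℕ → ℝ) (h' h l p : ℕ) : ℝ :=
  if partialCount b (p + h) = partialCount b (p + h') + l then y (p + h) * y (p + h') else 0

/-- Each `p` is sorted by the increment `l` of the count, which lies in `[0, M]`. Composing with
`T^[N + M - u p]` preserves the integral and turns the `f` part into `F l (T^[N + M] x)`, the same
for all `p` and bounded by `1`. The rest is a weighted sum `V l` of translates of `G`, to which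
transference applies. -/
theorem norm_sum_correlation_le {Y : Type*} [MeasurableSpace Y] {μ : Measure Y}
    [IsProbabilityMeasure μ] {T S : Y → Y} (hT : MeasurePreserving T μ μ)
    (hS : MeasurePreserving S μ μ) (hTS : Function.Commute T S) {f g : Y → ℂ}
    (hf : Measurable f) (hg : Measurable g) (hf1 : ∀ x, ‖f x‖ ≤ 1) (hg1 : ∀ x, ‖g x‖ ≤ 1)
    {b : ℕ → ℕ} (hb : ∀ n, b n ≤ 1) {y : ℕ → ℝ} {N M h' h : ℕ} (hlt : h' < h)
    (hM : h < M) {B : ℝ} (hB0 : 0 < B)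
    (hB : ∀ l ≤ M, ∀ ψ : AddChar (ZMod (2 * (N + M + 1)) × ZMod (2 * (N + M + 1))) ℂ,
      ‖∑ p ∈ Finset.range N, (correlationWeight b y h' h l p : ℂ) *
        ψ ((p : ZMod (2 * (N + M + 1))),
          ((N + M - partialCount b (p + h') : ℕ) : ZMod (2 * (N + M + 1))))‖ ≤ B) :
    ‖∑ p ∈ Finset.range N, ∫ x,
        ((y (p + h) : ℂ) * (f (T^[partialCount b (p + h)] x) * g (S^[p + h] x))) *
        (starRingEnd ℂ)
          ((y (p + h') : ℂ) * (f (T^[partialCount b (p + h')] x) * g (S^[p + h'] x))) ∂μ‖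
      ≤ (M + 1) * (2 * B) := by
  have hcm : Measurable (starRingEnd ℂ : ℂ → ℂ) := Complex.continuous_conj.measurable
  have hTm := fun n => hT.measurable.iterate n
  have hSm := fun n => hS.measurable.iterate n
  set F : ℕ → Y → ℂ := fun l x => f (T^[l] x) * (starRingEnd ℂ) (f x) with hF
  set G : Y → ℂ := fun x => g (S^[h] x) * (starRingEnd ℂ) (g (S^[h'] x)) with hG
  have hFm : ∀ l, Measurable (F l) := fun l => (hf.comp (hTm l)).mul (hcm.comp hf)
  have hGm : Measurable G := (hg.comp (hSm h)).mul (hcm.comp (hg.comp (hSm h')))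
  have hF1 : ∀ l x, ‖F l x‖ ≤ 1 := fun l x => by
    simp only [hF, norm_mul, RCLike.norm_conj]
    exact mul_le_one₀ (hf1 _) (norm_nonneg _) (hf1 _)
  have hG1 : ∀ x, ‖G x‖ ≤ 1 := fun x => by
    simp only [hG, norm_mul, RCLike.norm_conj]
    exact mul_le_one₀ (hg1 _) (norm_nonneg _) (hg1 _)
  set u : ℕ → ℕ := fun p => partialCount b (p + h') with hu
  set w : ℕ → ℕ → ℂ := fun l p => (correlationWeight b y h' h l p : ℂ) with hw
  set V : ℕ → Y → ℂ := fun l x => ∑ p ∈ Finset.range N, w l p * G (S^[p] (T^[N + M - u p] x))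
    with hV
  have hVm : ∀ l, Measurable (V l) := fun l => Finset.measurable_fun_sum _ fun p _ =>
    (hGm.comp ((hSm p).comp (hTm _))).const_mul _
  have huK : ∀ p ∈ Finset.range N, u p ≤ N + M := fun p hp => by
    have := partialCount_le hb (p + h')
    have := Finset.mem_range.1 hp
    simp only [hu]; omega
  have hVb : ∀ l x, ‖V l x‖ ≤ ∑ p ∈ Finset.range N, ‖w l p‖ := fun l x =>
    (norm_sum_le _ _).trans (Finset.sum_le_sum fun p _ => by
      rw [norm_mul]; exact mul_le_of_le_one_right (norm_nonneg _) (hG1 _))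
  have hVint : ∀ l ≤ M, ∫ x, ‖V l x‖ ∂μ ≤ 2 * B := by
    intro l hl
    have h2 : ∫ x, ‖V l x‖ ^ 2 ∂μ ≤ 4 * B ^ 2 :=
      integral_normSq_sum_le_of_addChar hT hS hTS hGm hG1 (Finset.range N) (w l) (fun p => p)
        (fun p => N + M - u p) (N + M + 1) (fun p hp => by have := Finset.mem_range.1 hp; omega)
        (fun p _ => by omega) (hB l hl)
    have hi1 : Integrable (fun x => ‖V l x‖) μ :=
      Integrable.of_bound (hVm l).norm.aestronglyMeasurable _
        (Eventually.of_forall fun x => by rw [norm_norm]; exact hVb l x)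
    have hi2 : Integrable (fun x => ‖V l x‖ ^ 2) μ :=
      Integrable.of_bound ((hVm l).norm.pow_const 2).aestronglyMeasurable
        ((∑ p ∈ Finset.range N, ‖w l p‖) ^ 2)
        (Eventually.of_forall fun x => by
          rw [Real.norm_of_nonneg (by positivity)]
          exact pow_le_pow_left₀ (norm_nonneg _) (hVb l x) 2)
    -- The inequality `4 * B * t ≤ t ^ 2 + 4 * B ^ 2` passes from the mean square to the mean.
    have h3 := integral_mono (hi1.const_mul (4 * B)) (hi2.add (integrable_const (4 * B ^ 2)))
      (fun x => by simp only [Pi.add_apply]; nlinarith [sq_nonneg (‖V l x‖ - 2 * B)])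
    rw [integral_const_mul, integral_add' hi2 (integrable_const _)] at h3
    simp only [integral_const, probReal_univ, smul_eq_mul, one_mul] at h3
    have : 4 * B * ∫ x, ‖V l x‖ ∂μ ≤ 4 * B * (2 * B) := by nlinarith
    exact le_of_mul_le_mul_left this (by positivity)
  have hmain : ∑ p ∈ Finset.range N, ∫ x,
        ((y (p + h) : ℂ) * (f (T^[partialCount b (p + h)] x) * g (S^[p + h] x))) *
        (starRingEnd ℂ)
          ((y (p + h') : ℂ) * (f (T^[partialCount b (p + h')] x) * g (S^[p + h'] x))) ∂μ
      = ∑ l ∈ Finset.range (M + 1), ∫ x, F l (T^[N + M] x) * V l x ∂μ := by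
    have hint : ∀ l p, Integrable
        (fun x => F l (T^[N + M] x) * (w l p * G (S^[p] (T^[N + M - u p] x)))) μ := fun l p =>
      Integrable.of_bound (((hFm l).comp (hTm _)).mul
        ((hGm.comp ((hSm p).comp (hTm _))).const_mul _)).aestronglyMeasurable ‖w l p‖
        (Eventually.of_forall fun x => by
          rw [norm_mul, norm_mul (w l p)]
          exact (mul_le_of_le_one_left (mul_nonneg (norm_nonneg (w l p))
            (norm_nonneg (G (S^[p] (T^[N + M - u p] x))))) (hF1 _ _)).trans
            (mul_le_of_le_one_right (norm_nonneg _) (hG1 _)))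
    simp only [hV, Finset.mul_sum]
    simp_rw [integral_finsetSum _ fun p (_ : p ∈ Finset.range N) => hint _ p]
    rw [Finset.sum_comm]
    refine Finset.sum_congr rfl fun p hp => ?_
    have hu2 : partialCount b (p + h) ≤ u p + M := by
      have := partialCount_add_le hb (p + h') (h - h')
      rw [show p + h' + (h - h') = p + h by omega] at this
      simp only [hu]; omega
    have hu1 : u p ≤ partialCount b (p + h) := partialCount_mono b (by omega)
    have hl0 : partialCount b (p + h) - u p ∈ Finset.range (M + 1) :=
      Finset.mem_range.2 (by omega)
    -- For each `p`, only the actual increment of the count can carry a nonzero weight.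
    rw [Finset.sum_eq_single_of_mem _ hl0]
    · have hwl : w (partialCount b (p + h) - u p) p = (y (p + h) : ℂ) * y (p + h') := by
        simp only [hw, correlationWeight]
        rw [if_pos (by simp only [hu] at hu1 ⊢; omega)]
        push_cast; rfl
      have hp' := hT.iterate (N + M - u p)
      rw [hwl]
      set Φ : Y → ℂ := fun x => (y (p + h) : ℂ) * y (p + h') *
        (F (partialCount b (p + h) - u p) (T^[u p] x) * G (S^[p] x)) with hΦ
      have hΦm : AEStronglyMeasurable Φ μ :=
        ((((hFm _).comp (hTm _)).mul (hGm.comp (hSm p))).const_mul _).aestronglyMeasurable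
      have e : ∀ x, F (partialCount b (p + h) - u p) (T^[N + M] x)
          * ((y (p + h) : ℂ) * y (p + h') * G (S^[p] (T^[N + M - u p] x)))
          = Φ (T^[N + M - u p] x) := by
        intro x
        simp only [hΦ]
        rw [← Function.iterate_add_apply, show u p + (N + M - u p) = N + M by
          have := huK p hp; omega]
        ring
      have hcomp : ∫ x, Φ (T^[N + M - u p] x) ∂μ = ∫ x, Φ x ∂μ := by
        rw [← integral_map hp'.measurable.aemeasurable (by rwa [hp'.map_eq]), hp'.map_eq]
      simp_rw [e]
      rw [hcomp]
      refine integral_congr_ae (Eventually.of_forall fun x => ?_)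
      simp only [hΦ, hF, hG, ← Function.iterate_add_apply, map_mul, Complex.conj_ofReal]
      rw [show partialCount b (p + h) - u p + u p = partialCount b (p + h) by omega,
        add_comm h p, add_comm h' p]
      ring
    · intro l _ hl
      have : w l p = 0 := by
        simp only [hw, correlationWeight]
        rw [if_neg (by simp only [hu] at hl hu1 ⊢; omega)]
        simp
      simp [this]
  rw [hmain]
  refine (norm_sum_le _ _).trans ?_
  calc _ ≤ ∑ l ∈ Finset.range (M + 1), 2 * B := Finset.sum_le_sum fun l hl => by
        refine (norm_integral_le_integral_norm _).trans (le_trans ?_ (hVint l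
          (Nat.lt_succ_iff.1 (Finset.mem_range.1 hl))))
        refine integral_mono_of_nonneg (Eventually.of_forall fun x => norm_nonneg _)
          (Integrable.of_bound (hVm l).norm.aestronglyMeasurable _
            (Eventually.of_forall fun x => by rw [norm_norm]; exact hVb l x))
          (Eventually.of_forall fun x => ?_)
        simp only [norm_mul]
        exact mul_le_of_le_one_left (norm_nonneg _) (hF1 _ _)
    _ = _ := by simp

/-! ### Azuma's inequality -/

theorem exp_mul_le_cosh_add_mul_sinh (l : ℝ) {z : ℝ} (hz : |z| ≤ 1) :
    Real.exp (l * z) ≤ Real.cosh l + z * Real.sinh l := by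
  obtain ⟨h1, h2⟩ := abs_le.1 hz
  have := convexOn_exp.2 (Set.mem_univ l) (Set.mem_univ (-l))
    (show 0 ≤ (1 + z) / 2 by linarith) (show 0 ≤ (1 - z) / 2 by linarith) (by ring)
  simp only [smul_eq_mul] at this
  rw [Real.cosh_eq, Real.sinh_eq]
  calc Real.exp (l * z) = Real.exp ((1 + z) / 2 * l + (1 - z) / 2 * -l) := by congr 1; ring
    _ ≤ _ := this
    _ = _ := by ring

section Martingale

variable {Ω : Type*} [mΩ : MeasurableSpace Ω] {P : Measure Ω} [IsProbabilityMeasure P]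
  {m : ℕ → MeasurableSpace Ω} {Z : ℕ → Ω → ℝ}

/-- Induction on `N`: the new exponential factor is at most `cosh l` plus `sinh l` times `Z N * c
N`. The other factors of that last term are `m N`-measurable, hence independent of the centred `Z
N`, so it integrates to `0`; and `cosh l ≤ exp (l ^ 2 / 2)`. -/
theorem integral_exp_sum_mul_le (hm : ∀ n, m n ≤ mΩ) (hmono : Monotone m)
    (hZm : ∀ n, Measurable[m (n + 1)] (Z n)) (hZ1 : ∀ n ω, |Z n ω| ≤ 1)
    (hZ0 : ∀ n, ∫ ω, Z n ω ∂P = 0)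
    (hZind : ∀ n, Indep (m n) (MeasurableSpace.comap (Z n) inferInstance) P)
    {c : ℕ → Ω → ℝ} (hcm : ∀ n, Measurable[m n] (c n)) (hc1 : ∀ n ω, |c n ω| ≤ 1)
    (l : ℝ) (N : ℕ) :
    ∫ ω, Real.exp (l * ∑ n ∈ Finset.range N, Z n ω * c n ω) ∂P
      ≤ Real.exp (l ^ 2 / 2 * N) := by
  have hEm : ∀ N, Measurable[m N]
      (fun ω => Real.exp (l * ∑ n ∈ Finset.range N, Z n ω * c n ω)) := fun N =>
    Real.measurable_exp.comp (Measurable.const_mul (Finset.measurable_fun_sum _ fun n hn =>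
      ((hZm n).mono (hmono (Finset.mem_range.1 hn)) le_rfl).mul
        ((hcm n).mono (hmono (Finset.mem_range.1 hn).le) le_rfl)) l)
  have hEb : ∀ N ω, ‖Real.exp (l * ∑ n ∈ Finset.range N, Z n ω * c n ω)‖
      ≤ Real.exp (|l| * N) := by
    intro N ω
    rw [Real.norm_of_nonneg (Real.exp_nonneg _)]
    refine Real.exp_le_exp.2 ((le_abs_self _).trans ?_)
    rw [abs_mul]
    gcongr
    refine (Finset.abs_sum_le_sum_abs _ _).trans ?_
    calc _ ≤ ∑ n ∈ Finset.range N, (1 : ℝ) := Finset.sum_le_sum fun n _ => by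
          rw [abs_mul]; exact mul_le_one₀ (hZ1 _ _) (abs_nonneg _) (hc1 _ _)
      _ = N := by simp
  have hEi : ∀ N, Integrable
      (fun ω => Real.exp (l * ∑ n ∈ Finset.range N, Z n ω * c n ω)) P := fun N =>
    Integrable.of_bound ((hEm N).mono (hm N) le_rfl).aestronglyMeasurable _
      (Eventually.of_forall (hEb N))
  induction N with
  | zero => simp
  | succ N ih =>
    set E : Ω → ℝ := fun ω => Real.exp (l * ∑ n ∈ Finset.range N, Z n ω * c n ω) with hE
    have hind : IndepFun (fun ω => E ω * c N ω) (Z N) P := by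
      rw [IndepFun_iff_Indep]
      exact indep_of_indep_of_le_left (hZind N) ((hEm N).mul (hcm N)).comap_le
    have hZm' : Measurable (Z N) := (hZm N).mono (hm _) le_rfl
    have hEcm : Measurable fun ω => E ω * c N ω := ((hEm N).mul (hcm N)).mono (hm N) le_rfl
    have h0 : ∫ ω, (E ω * c N ω) * Z N ω ∂P = 0 := by
      have := hind.integral_fun_mul_eq_mul_integral hEcm.aestronglyMeasurable
        hZm'.aestronglyMeasurable
      rw [this, hZ0 N, mul_zero]
    have hi2 : Integrable (fun ω => (E ω * c N ω) * Z N ω) P :=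
      Integrable.of_bound (hEcm.mul hZm').aestronglyMeasurable (Real.exp (|l| * N))
        (Eventually.of_forall fun ω => by
          rw [norm_mul, norm_mul, mul_assoc]
          exact (mul_le_of_le_one_right (norm_nonneg _)
            (mul_le_one₀ (hc1 _ _) (norm_nonneg _) (hZ1 _ _))).trans (hEb N ω))
    have hle : ∀ ω, Real.exp (l * ∑ n ∈ Finset.range (N + 1), Z n ω * c n ω)
        ≤ Real.cosh l * E ω + Real.sinh l * ((E ω * c N ω) * Z N ω) := by
      intro ω
      rw [Finset.sum_range_succ, mul_add, Real.exp_add]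
      have h1 : |Z N ω * c N ω| ≤ 1 := by
        rw [abs_mul]; exact mul_le_one₀ (hZ1 _ _) (abs_nonneg _) (hc1 _ _)
      refine (mul_le_mul_of_nonneg_left (exp_mul_le_cosh_add_mul_sinh l h1)
        (Real.exp_nonneg _)).trans (le_of_eq ?_)
      simp only [hE]; ring
    have hI := integral_mono (hEi (N + 1)) (((hEi N).const_mul (Real.cosh l)).add
      (hi2.const_mul (Real.sinh l))) hle
    rw [integral_add' ((hEi N).const_mul (Real.cosh l)) (hi2.const_mul (Real.sinh l)),
      integral_const_mul, integral_const_mul, h0, mul_zero, add_zero] at hI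
    refine hI.trans ?_
    calc _ ≤ Real.exp (l ^ 2 / 2) * Real.exp (l ^ 2 / 2 * N) := by
          gcongr
          · exact Real.cosh_le_exp_half_sq l
      _ = _ := by rw [← Real.exp_add]; congr 1; push_cast; ring

theorem measureReal_le_sum_mul_le (hm : ∀ n, m n ≤ mΩ) (hmono : Monotone m)
    (hZm : ∀ n, Measurable[m (n + 1)] (Z n)) (hZ1 : ∀ n ω, |Z n ω| ≤ 1)
    (hZ0 : ∀ n, ∫ ω, Z n ω ∂P = 0)
    (hZind : ∀ n, Indep (m n) (MeasurableSpace.comap (Z n) inferInstance) P)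
    {c : ℕ → Ω → ℝ} (hcm : ∀ n, Measurable[m n] (c n)) (hc1 : ∀ n ω, |c n ω| ≤ 1)
    {t : ℝ} (ht : 0 ≤ t) {N : ℕ} (hN : 0 < N) :
    P.real {ω | t ≤ ∑ n ∈ Finset.range N, Z n ω * c n ω} ≤ Real.exp (-(t ^ 2 / (2 * N))) := by
  have hN' : (0 : ℝ) < N := by exact_mod_cast hN
  have hSm : Measurable fun ω => ∑ n ∈ Finset.range N, Z n ω * c n ω :=
    Finset.measurable_fun_sum _ fun n _ =>
      ((hZm n).mono (hm _) le_rfl).mul ((hcm n).mono (hm _) le_rfl)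
  -- The parameter `t / N` minimises the exponent `l ^ 2 / 2 * N - l * t`.
  have h := measure_ge_le_exp_mul_mgf (μ := P) (t := t / N)
    (X := fun ω => ∑ n ∈ Finset.range N, Z n ω * c n ω) t (by positivity)
    (Integrable.of_bound (Real.measurable_exp.comp (hSm.const_mul _)).aestronglyMeasurable
      (Real.exp (t / N * N)) (Eventually.of_forall fun ω => by
        rw [Real.norm_of_nonneg (Real.exp_nonneg _)]
        refine Real.exp_le_exp.2 (mul_le_mul_of_nonneg_left ?_ (by positivity))
        refine (le_abs_self _).trans ((Finset.abs_sum_le_sum_abs _ _).trans ?_)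
        calc _ ≤ ∑ n ∈ Finset.range N, (1 : ℝ) := Finset.sum_le_sum fun n _ => by
              rw [abs_mul]; exact mul_le_one₀ (hZ1 _ _) (abs_nonneg _) (hc1 _ _)
          _ = N := by simp))
  refine h.trans ((mul_le_mul_of_nonneg_left
    (integral_exp_sum_mul_le hm hmono hZm hZ1 hZ0 hZind hcm hc1 (t / N) N)
    (Real.exp_nonneg _)).trans (le_of_eq ?_))
  rw [← Real.exp_add]
  congr 1
  field_simp
  ring

/-- A modulus above `2 * t` forces the real or the imaginary part, up to sign, to be at least `t`:
four one-sided events. -/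
theorem measureReal_lt_norm_sum_mul_le (hm : ∀ n, m n ≤ mΩ) (hmono : Monotone m)
    (hZm : ∀ n, Measurable[m (n + 1)] (Z n)) (hZ1 : ∀ n ω, |Z n ω| ≤ 1)
    (hZ0 : ∀ n, ∫ ω, Z n ω ∂P = 0)
    (hZind : ∀ n, Indep (m n) (MeasurableSpace.comap (Z n) inferInstance) P)
    {c : ℕ → Ω → ℂ} (hcm : ∀ n, Measurable[m n] (c n)) (hc1 : ∀ n ω, ‖c n ω‖ ≤ 1)
    {t : ℝ} (ht : 0 ≤ t) {N : ℕ} (hN : 0 < N) :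
    P.real {ω | 2 * t < ‖∑ n ∈ Finset.range N, (Z n ω : ℂ) * c n ω‖}
      ≤ 4 * Real.exp (-(t ^ 2 / (2 * N))) := by
  have hre : ∀ n, Measurable[m n] fun ω => (c n ω).re := fun n =>
    Complex.measurable_re.comp (hcm n)
  have him : ∀ n, Measurable[m n] fun ω => (c n ω).im := fun n =>
    Complex.measurable_im.comp (hcm n)
  have hre1 : ∀ n ω, |(c n ω).re| ≤ 1 := fun n ω => (Complex.abs_re_le_norm _).trans (hc1 n ω)
  have him1 : ∀ n ω, |(c n ω).im| ≤ 1 := fun n ω => (Complex.abs_im_le_norm _).trans (hc1 n ω)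
  have h1 := measureReal_le_sum_mul_le hm hmono hZm hZ1 hZ0 hZind hre hre1 ht hN
  have h2 := measureReal_le_sum_mul_le hm hmono hZm hZ1 hZ0 hZind him him1 ht hN
  have h3 := measureReal_le_sum_mul_le hm hmono hZm hZ1 hZ0 hZind (c := fun n ω => -(c n ω).re)
    (fun n => (hre n).neg) (fun n ω => by rw [abs_neg]; exact hre1 n ω) ht hN
  have h4 := measureReal_le_sum_mul_le hm hmono hZm hZ1 hZ0 hZind (c := fun n ω => -(c n ω).im)
    (fun n => (him n).neg) (fun n ω => by rw [abs_neg]; exact him1 n ω) ht hN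
  have hsub : {ω | 2 * t < ‖∑ n ∈ Finset.range N, (Z n ω : ℂ) * c n ω‖} ⊆
      ({ω | t ≤ ∑ n ∈ Finset.range N, Z n ω * (c n ω).re} ∪
        {ω | t ≤ ∑ n ∈ Finset.range N, Z n ω * (c n ω).im}) ∪
      ({ω | t ≤ ∑ n ∈ Finset.range N, Z n ω * -(c n ω).re} ∪
        {ω | t ≤ ∑ n ∈ Finset.range N, Z n ω * -(c n ω).im}) := by
    intro ω hω
    simp only [Set.mem_ofPred_eq, Set.mem_union, mul_neg, Finset.sum_neg_distrib] at hω ⊢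
    by_contra! hcon
    obtain ⟨⟨a1, a2⟩, a3, a4⟩ := hcon
    have hn := Complex.norm_le_abs_re_add_abs_im (∑ n ∈ Finset.range N, (Z n ω : ℂ) * c n ω)
    simp only [Complex.re_sum, Complex.im_sum, Complex.re_ofReal_mul, Complex.im_ofReal_mul] at hn
    have b1 : |∑ n ∈ Finset.range N, Z n ω * (c n ω).re| < t := abs_lt.2 ⟨by linarith, a1⟩
    have b2 : |∑ n ∈ Finset.range N, Z n ω * (c n ω).im| < t := abs_lt.2 ⟨by linarith, a2⟩
    linarith
  refine (measureReal_mono hsub).trans ?_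
  refine (measureReal_union_le _ _).trans ?_
  have := measureReal_union_le (μ := P) {ω | t ≤ ∑ n ∈ Finset.range N, Z n ω * (c n ω).re}
    {ω | t ≤ ∑ n ∈ Finset.range N, Z n ω * (c n ω).im}
  have := measureReal_union_le (μ := P) {ω | t ≤ ∑ n ∈ Finset.range N, Z n ω * -(c n ω).re}
    {ω | t ≤ ∑ n ∈ Finset.range N, Z n ω * -(c n ω).im}
  linarith

end Martingale

/-! ### Almost sure bounds for the random exponential sums -/

/-- The hypothesis of `norm_sum_correlation_le`, for all pairs of shifts below `M`. -/
def CorrelationBound (b : ℕ → ℕ) (y : ℕ → ℝ) (N M : ℕ) (B : ℝ) : Prop :=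
  ∀ h' h, h' < h → h < M → ∀ l ≤ M,
    ∀ ψ : AddChar (ZMod (2 * (N + M + 1)) × ZMod (2 * (N + M + 1))) ℂ,
      ‖∑ p ∈ Finset.range N, (correlationWeight b y h' h l p : ℂ) *
        ψ ((p : ZMod (2 * (N + M + 1))),
          ((N + M - partialCount b (p + h') : ℕ) : ZMod (2 * (N + M + 1))))‖ ≤ B

section Bernoulli

variable {Ω : Type*} {b : ℕ → Ω → ℕ}

/-- The σ-algebra generated by the random variables `b i`, `i < n`. -/
abbrev pastSigmaAlgebra (b : ℕ → Ω → ℕ) (n : ℕ) : MeasurableSpace Ω :=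
  ⨆ i ∈ Set.Iio n, MeasurableSpace.comap (b i) inferInstance

theorem pastSigmaAlgebra_mono (b : ℕ → Ω → ℕ) : Monotone (pastSigmaAlgebra b) :=
  fun _ _ h => biSup_mono fun _ hi => lt_of_lt_of_le hi h

theorem measurable_pastSigmaAlgebra {i n : ℕ} (h : i < n) :
    Measurable[pastSigmaAlgebra b n] (b i) :=
  (comap_measurable (b i)).mono (le_iSup₂ (f := fun i (_ : i ∈ Set.Iio n) =>
    MeasurableSpace.comap (b i) inferInstance) i h) le_rfl

theorem measurable_partialCount_pastSigmaAlgebra {k n : ℕ} (h : k ≤ n) :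
    Measurable[pastSigmaAlgebra b n] fun ω => partialCount (fun i => b i ω) k :=
  Finset.measurable_fun_sum _ fun _ hi =>
    measurable_pastSigmaAlgebra ((Finset.mem_range.1 hi).trans_le h)

variable [mΩ : MeasurableSpace Ω] {P : Measure Ω}

theorem pastSigmaAlgebra_le (hbm : ∀ n, Measurable (b n)) (n : ℕ) :
    pastSigmaAlgebra b n ≤ mΩ :=
  iSup₂_le fun i _ => (hbm i).comap_le

theorem indep_pastSigmaAlgebra (hbm : ∀ n, Measurable (b n)) (hind : iIndepFun b P) (n : ℕ) :
    Indep (pastSigmaAlgebra b n) (MeasurableSpace.comap (b n) inferInstance) P := by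
  have := indep_iSup_of_disjoint (fun i => (hbm i).comap_le) hind
    (S := Set.Iio n) (T := {n}) (by simp)
  simpa [pastSigmaAlgebra] using this

variable [IsProbabilityMeasure P] {τ : ℕ → ℝ}

/-- For fixed `h' < h`, `l` and `ψ`, the coefficient of `y (p + h)` depends only on `b i` with `i <
p + h`. Azuma with `t = j ^ 28` and `N = j ^ 48` gives the tail `4 * exp (-j ^ 8 / 2)`, weakened to
`4 * exp (-j / 2)`. The group being finite, only polynomially many choices occur, and Borel–Cantelli
applies. -/
theorem ae_eventually_correlationBound (hbm : ∀ n, Measurable (b n)) (hind : iIndepFun b P)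
    (hb1 : ∀ n ω, b n ω ≤ 1) (hτ : ∀ n, P.real {ω | b n ω = 1} = τ n) :
    ∀ᵐ ω ∂P, ∀ᶠ j : ℕ in atTop,
      CorrelationBound (fun n => b n ω) (fun n => b n ω - τ n) (j ^ 48) (j ^ 8) (2 * j ^ 28) ∧
      |∑ p ∈ Finset.range (j ^ 48), ((b p ω : ℝ) - τ p)| ≤ 2 * j ^ 28 := by
  set Z : ℕ → Ω → ℝ := fun n ω => (b n ω : ℝ) - τ n with hZ
  have hτ01 : ∀ n, 0 ≤ τ n ∧ τ n ≤ 1 := fun n => by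
    rw [← hτ n]; exact ⟨measureReal_nonneg, measureReal_le_one⟩
  have hZm : ∀ n, Measurable[pastSigmaAlgebra b (n + 1)] (Z n) := fun n =>
    (Measurable.of_discrete (f := fun k : ℕ => (k : ℝ) - τ n)).comp
      (measurable_pastSigmaAlgebra (Nat.lt_succ_self n))
  have hZ1 : ∀ n ω, |Z n ω| ≤ 1 := fun n ω => by
    have h1 : (b n ω : ℝ) ≤ 1 := by exact_mod_cast hb1 n ω
    have h2 : (0 : ℝ) ≤ b n ω := Nat.cast_nonneg _
    have h3 := hτ01 n
    simp only [hZ]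
    rw [abs_le]; constructor <;> linarith [h3.1, h3.2]
  have hZ0 : ∀ n, ∫ ω, Z n ω ∂P = 0 := fun n => by
    have hms : MeasurableSet {ω | b n ω = 1} := hbm n (measurableSet_singleton 1)
    have e : ∀ ω, (b n ω : ℝ) = Set.indicator {ω | b n ω = 1} (fun _ => (1 : ℝ)) ω := fun ω => by
      have := hb1 n ω
      by_cases h : b n ω = 1
      · simp [h]
      · have h0 : b n ω = 0 := by omega
        simp [h0]
    simp only [hZ]
    simp_rw [e]
    rw [integral_sub ((integrable_const _).indicator hms) (integrable_const _),
      integral_indicator_const _ hms, hτ n]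
    simp
  have hZind : ∀ n, Indep (pastSigmaAlgebra b n)
      (MeasurableSpace.comap (Z n) inferInstance) P := fun n => by
    refine indep_of_indep_of_le_right (indep_pastSigmaAlgebra hbm hind n) ?_
    have : Measurable[MeasurableSpace.comap (b n) inferInstance] (Z n) :=
      (Measurable.of_discrete (f := fun k : ℕ => (k : ℝ) - τ n)).comp (comap_measurable (b n))
    exact this.comap_le
  have hm := pastSigmaAlgebra_le hbm
  have hmono := pastSigmaAlgebra_mono b
  have htail : ∀ (j : ℕ), 1 ≤ j → ∀ (h : ℕ) (c : ℕ → Ω → ℂ),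
      (∀ n, Measurable[pastSigmaAlgebra b (n + h)] (c n)) → (∀ n ω, ‖c n ω‖ ≤ 1) →
      P.real {ω | 2 * (j : ℝ) ^ 28 < ‖∑ n ∈ Finset.range (j ^ 48), (Z (n + h) ω : ℂ) * c n ω‖}
      ≤ 4 * Real.exp (-(1 / 2 * j)) := by
    intro j hj h c hc hc1
    have hj' : (1 : ℝ) ≤ j := by exact_mod_cast hj
    refine (measureReal_lt_norm_sum_mul_le (m := fun n => pastSigmaAlgebra b (n + h))
      (Z := fun n => Z (n + h)) (fun n => hm _) (fun x y hxy => hmono (by omega))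
      (fun n => by have := hZm (n + h); rwa [show n + h + 1 = n + 1 + h by ring] at this)
      (fun n => hZ1 _) (fun n => hZ0 _) (fun n => hZind _) hc hc1 (t := (j : ℝ) ^ 28)
      (by positivity) (N := j ^ 48) (by positivity)).trans ?_
    gcongr
    push_cast
    have : ((j : ℝ) ^ 28) ^ 2 / (2 * j ^ 48) = 1 / 2 * (j : ℝ) ^ 8 := by
      field_simp
    rw [this]
    gcongr
    exact le_self_pow₀ hj' (by norm_num)
  set bad₁ : ℕ → Set Ω := fun j =>
    {ω | ¬ CorrelationBound (fun n => b n ω) (fun n => b n ω - τ n) (j ^ 48) (j ^ 8)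
      (2 * j ^ 28)} with hbad₁
  set bad₂ : ℕ → Set Ω := fun j =>
    {ω | 2 * (j : ℝ) ^ 28 < ‖∑ n ∈ Finset.range (j ^ 48), (Z (n + 0) ω : ℂ) * 1‖} with hbad₂
  have hP2 : ∀ j : ℕ, 1 ≤ j → P.real (bad₂ j) ≤ 4 * Real.exp (-(1 / 2 * j)) := fun j hj =>
    htail j hj 0 (fun _ _ => 1) (fun _ => measurable_const) (fun _ _ => by simp)
  have hP1 : ∀ j : ℕ, 1 ≤ j → P.real (bad₁ j)
      ≤ 72 * (j : ℝ) ^ 120 * (4 * Real.exp (-(1 / 2 * j))) := by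
    intro j hj
    set N := j ^ 48
    set M := j ^ 8
    set E : (ℕ × ℕ) × ℕ × AddChar (ZMod (2 * (N + M + 1)) × ZMod (2 * (N + M + 1))) ℂ → Set Ω :=
      fun q => {ω | q.1.1 < q.1.2 ∧ 2 * (j : ℝ) ^ 28 < ‖∑ p ∈ Finset.range N,
        (correlationWeight (fun n => b n ω) (fun n => b n ω - τ n) q.1.1 q.1.2 q.2.1 p : ℂ) *
        q.2.2 ((p : ZMod (2 * (N + M + 1))),
          ((N + M - partialCount (fun n => b n ω) (p + q.1.1) : ℕ) :
            ZMod (2 * (N + M + 1))))‖} with hE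
    set I := (Finset.range M ×ˢ Finset.range M) ×ˢ Finset.range (M + 1) ×ˢ
      (Finset.univ : Finset (AddChar (ZMod (2 * (N + M + 1)) × ZMod (2 * (N + M + 1))) ℂ)) with hI
    have hsub : bad₁ j ⊆ ⋃ q ∈ I, E q := by
      intro ω hω
      simp only [hbad₁, CorrelationBound, Set.mem_ofPred_eq] at hω
      push Not at hω
      obtain ⟨h', h, hlt, hM, l, hl, ψ, hψ⟩ := hω
      simp only [Set.mem_iUnion]
      refine ⟨((h', h), l, ψ), ?_, hlt, hψ⟩
      simp only [hI, Finset.mem_product, Finset.mem_range, Finset.mem_univ, and_true]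
      omega
    have hEq : ∀ q ∈ I, P.real (E q) ≤ 4 * Real.exp (-(1 / 2 * j)) := by
      rintro ⟨⟨h', h⟩, l, ψ⟩ -
      by_cases hlt : h' < h
      -- Written as a function of three natural numbers known before time `p + h`, the coefficient
      -- is measurable because its domain is discrete.
      · set Φ : ℕ → ℕ × ℕ × ℕ → ℂ := fun p r =>
          (if r.1 = r.2.1 + l then ((r.2.2 : ℝ) - τ (p + h') : ℂ) else 0) *
            ψ ((p : ZMod (2 * (N + M + 1))), ((N + M - r.2.1 : ℕ) : ZMod (2 * (N + M + 1))))
          with hΦ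
        have hΦm : ∀ p, Measurable (Φ p) := fun p => .of_discrete
        refine le_trans (le_of_eq ?_) (htail j hj h (fun p ω => Φ p
          (partialCount (fun n => b n ω) (p + h), partialCount (fun n => b n ω) (p + h'),
            b (p + h') ω)) (fun p => ?_) (fun p ω => ?_))
        · congr 1
          ext ω
          simp only [hE, hlt, true_and, Set.mem_ofPred_eq]
          have : ∀ u v : ℂ, u = v → (2 * (j : ℝ) ^ 28 < ‖u‖ ↔ 2 * (j : ℝ) ^ 28 < ‖v‖) :=
            fun u v h => by rw [h]
          refine this _ _ (Finset.sum_congr rfl fun p _ => ?_)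
          simp only [correlationWeight, hZ, hΦ]
          split_ifs <;> push_cast <;> ring
        · have m₁ := measurable_partialCount_pastSigmaAlgebra (b := b) (le_refl (p + h))
          have m₂ := measurable_partialCount_pastSigmaAlgebra (b := b)
            (show p + h' ≤ p + h by omega)
          have m₃ := measurable_pastSigmaAlgebra (b := b) (show p + h' < p + h by omega)
          exact (hΦm p).comp (m₁.prodMk (m₂.prodMk m₃))
        · simp only [hΦ]
          rw [norm_mul, AddChar.norm_apply, mul_one]
          split_ifs
          · have := hZ1 (p + h') ω
            simp only [hZ] at this
            rw [← Complex.ofReal_sub, Complex.norm_real]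
            exact_mod_cast this
          · simp
      · have : E ((h', h), l, ψ) = ∅ := by
          ext ω; simp [hE, hlt]
        rw [this]; simp; positivity
    refine (measureReal_mono hsub (measure_ne_top _ _)).trans ((measureReal_biUnion_finset_le _ _).trans
      ((Finset.sum_le_sum hEq).trans ?_))
    rw [Finset.sum_const, nsmul_eq_mul]
    gcongr
    have hcard : I.card = M * M * ((M + 1) * (2 * (N + M + 1) * (2 * (N + M + 1)))) := by
      simp only [hI, Finset.card_product, Finset.card_range, Finset.card_univ]
      congr 2
      rw [← Nat.card_eq_fintype_card, Nat.card_eq_fintype_card, AddChar.card_eq,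
        Fintype.card_prod, ZMod.card]
    rw [hcard]
    have hM1 : 1 ≤ M := Nat.one_le_pow _ _ hj
    have hMN : M ≤ N := Nat.pow_le_pow_right hj (by norm_num)
    have : M * M * ((M + 1) * (2 * (N + M + 1) * (2 * (N + M + 1))))
        ≤ M * M * ((2 * M) * (2 * (3 * N) * (2 * (3 * N)))) := by
      gcongr <;> omega
    calc ((M * M * ((M + 1) * (2 * (N + M + 1) * (2 * (N + M + 1)))) : ℕ) : ℝ)
        ≤ ((M * M * ((2 * M) * (2 * (3 * N) * (2 * (3 * N)))) : ℕ) : ℝ) := by exact_mod_cast this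
      _ = 72 * (j : ℝ) ^ 120 := by simp only [N, M]; push_cast; ring
  -- Here `292 = 72 * 4 + 4` collects the two bad events.
  have hsummable : Summable fun j : ℕ => 292 * ((j : ℝ) ^ 120 * Real.exp (-(1 / 2) * j)) :=
    (Real.summable_pow_mul_exp_neg_nat_mul 120 (by norm_num)).mul_left 292
  have hP : ∀ j : ℕ, P.real (bad₁ (j + 1) ∪ bad₂ (j + 1))
      ≤ 292 * (((j + 1 : ℕ) : ℝ) ^ 120 * Real.exp (-(1 / 2) * (j + 1 : ℕ))) := by
    intro j
    have h1 := hP1 (j + 1) (by omega)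
    have h2 := hP2 (j + 1) (by omega)
    have hx : (1 : ℝ) ≤ ((j + 1 : ℕ) : ℝ) ^ 120 := one_le_pow₀ (by simp)
    have he := Real.exp_nonneg (-(1 / 2 * ((j + 1 : ℕ) : ℝ)))
    have hu := measureReal_union_le (μ := P) (bad₁ (j + 1)) (bad₂ (j + 1))
    rw [neg_mul]
    nlinarith
  have hfin : ∑' j : ℕ, P (bad₁ (j + 1) ∪ bad₂ (j + 1)) ≠ ⊤ := by
    have hs' := (summable_nat_add_iff 1).2 hsummable
    refine ne_top_of_le_ne_top hs'.tsum_ofReal_ne_top (ENNReal.tsum_le_tsum fun j => ?_)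
    rw [← ofReal_measureReal]
    exact ENNReal.ofReal_le_ofReal (hP j)
  filter_upwards [ae_eventually_notMem hfin] with ω hω
  obtain ⟨J, hJ⟩ := eventually_atTop.1 hω
  filter_upwards [eventually_ge_atTop (J + 1)] with j hj
  have := hJ (j - 1) (by omega)
  rw [Nat.sub_add_cancel (by omega)] at this
  simp only [hbad₁, hbad₂, hZ, Set.mem_union, Set.mem_ofPred_eq, not_or, not_not, not_lt,
    add_zero, mul_one] at this
  refine ⟨this.1, ?_⟩
  have h2 := this.2
  rw [← Complex.ofReal_sum, Complex.norm_real] at h2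
  exact h2

end Bernoulli

/-! ### The maximal and the pointwise ergodic theorem -/

section Birkhoff

variable {Y : Type*}

/-- The largest Birkhoff sum of length at most `n` (including the empty sum). -/
noncomputable def maxBirkhoffSum (T : Y → Y) (φ : Y → ℝ) : ℕ → Y → ℝ
  | 0, _ => 0
  | n + 1, x => max 0 (φ x + maxBirkhoffSum T φ n (T x))

theorem maxBirkhoffSum_nonneg (T : Y → Y) (φ : Y → ℝ) (n : ℕ) (x : Y) :
    0 ≤ maxBirkhoffSum T φ n x := by
  cases n with
  | zero => exact le_rfl
  | succ n => exact le_max_left _ _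

theorem maxBirkhoffSum_le_succ (T : Y → Y) (φ : Y → ℝ) (n : ℕ) (x : Y) :
    maxBirkhoffSum T φ n x ≤ maxBirkhoffSum T φ (n + 1) x := by
  induction n generalizing x with
  | zero => exact le_max_left _ _
  | succ n ih => exact max_le_max le_rfl (by gcongr; exact ih _)

theorem birkhoffSum_le_maxBirkhoffSum (T : Y → Y) (φ : Y → ℝ) (n : ℕ) (x : Y) :
    birkhoffSum T φ n x ≤ maxBirkhoffSum T φ n x := by
  induction n generalizing x with
  | zero => simp [maxBirkhoffSum]
  | succ n ih =>
    rw [birkhoffSum_succ']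
    exact (add_le_add le_rfl (ih _)).trans (le_max_right _ _)

theorem exists_birkhoffSum_pos_of_maxBirkhoffSum_pos (T : Y → Y) (φ : Y → ℝ) {n : ℕ} {x : Y}
    (h : 0 < maxBirkhoffSum T φ n x) : ∃ k, 0 < birkhoffSum T φ k x := by
  have : ∀ n x, ∃ k, maxBirkhoffSum T φ n x ≤ birkhoffSum T φ k x := by
    intro n
    induction n with
    | zero => exact fun x => ⟨0, by simp [maxBirkhoffSum]⟩
    | succ n ih =>
      intro x
      obtain ⟨k, hk⟩ := ih (T x)
      rcases le_total 0 (φ x + maxBirkhoffSum T φ n (T x)) with h0 | h0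
      · refine ⟨k + 1, ?_⟩
        rw [birkhoffSum_succ']
        simp only [maxBirkhoffSum, max_eq_right h0]
        gcongr
      · exact ⟨0, by simp only [maxBirkhoffSum, max_eq_left h0, birkhoffSum_zero]; exact le_rfl⟩
  obtain ⟨k, hk⟩ := this n x
  exact ⟨k, h.trans_le hk⟩

variable [MeasurableSpace Y] {μ : Measure Y}

theorem measurable_maxBirkhoffSum {T : Y → Y} (hT : Measurable T) {φ : Y → ℝ}
    (hφ : Measurable φ) (n : ℕ) : Measurable (maxBirkhoffSum T φ n) := by
  induction n with
  | zero => exact measurable_const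
  | succ n ih => exact measurable_const.max (hφ.add (ih.comp hT))

theorem integrable_maxBirkhoffSum {T : Y → Y} (hT : MeasurePreserving T μ μ) {φ : Y → ℝ}
    (hφi : Integrable φ μ) (n : ℕ) : Integrable (maxBirkhoffSum T φ n) μ := by
  induction n with
  | zero => exact integrable_zero _ _ _
  | succ n ih =>
    exact (integrable_zero _ _ _).sup (hφi.add ((hT.integrable_comp_of_integrable ih)))

/-- The maximal ergodic theorem. -/
theorem setIntegral_exists_birkhoffSum_pos_nonneg {T : Y → Y} (hT : MeasurePreserving T μ μ)
    {φ : Y → ℝ} (hφ : Measurable φ) (hφi : Integrable φ μ) :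
    0 ≤ ∫ x in {x | ∃ k, 0 < birkhoffSum T φ k x}, φ x ∂μ := by
  set A : ℕ → Set Y := fun n => {x | 0 < maxBirkhoffSum T φ n x} with hA
  have hAm : ∀ n, MeasurableSet (A n) := fun n =>
    measurableSet_lt measurable_const (measurable_maxBirkhoffSum hT.measurable hφ n)
  have hmono : Monotone A := monotone_nat_of_le_succ fun n x hx =>
    lt_of_lt_of_le hx (maxBirkhoffSum_le_succ T φ n x)
  have hU : {x | ∃ k, 0 < birkhoffSum T φ k x} = ⋃ n, A n := by
    ext x
    simp only [hA, Set.mem_iUnion, Set.mem_ofPred_eq]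
    exact ⟨fun ⟨k, hk⟩ => ⟨k, hk.trans_le (birkhoffSum_le_maxBirkhoffSum T φ k x)⟩,
      fun ⟨n, hn⟩ => exists_birkhoffSum_pos_of_maxBirkhoffSum_pos T φ hn⟩
  rw [hU]
  refine ge_of_tendsto' (tendsto_setIntegral_of_monotone hAm hmono hφi.integrableOn) fun n => ?_
  have hi := integrable_maxBirkhoffSum hT hφi n
  have hi' := hT.integrable_comp_of_integrable hi
  -- Garsia's argument: where the maximum is positive it is `φ x` plus a shorter maximum at `T x`;
  -- elsewhere it is `0`, and the maximum at `T x` is nonnegative. The left side integrates to `0`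
  -- by invariance.
  have h1 : ∀ x, maxBirkhoffSum T φ n x - maxBirkhoffSum T φ n (T x)
      ≤ (A n).indicator φ x := by
    intro x
    by_cases hx : x ∈ A n
    · rw [Set.indicator_of_mem hx]
      have hx' : 0 < maxBirkhoffSum T φ n x := hx
      cases n with
      | zero => simp [maxBirkhoffSum] at hx'
      | succ n =>
        have h2 := maxBirkhoffSum_le_succ T φ n (T x)
        have h3 : maxBirkhoffSum T φ (n + 1) x = max 0 (φ x + maxBirkhoffSum T φ n (T x)) := rfl
        rcases le_total 0 (φ x + maxBirkhoffSum T φ n (T x)) with h0 | h0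
        · rw [max_eq_right h0] at h3; linarith
        · rw [max_eq_left h0] at h3; linarith
    · rw [Set.indicator_of_notMem hx]
      have hx' : maxBirkhoffSum T φ n x ≤ 0 := not_lt.1 hx
      have := maxBirkhoffSum_nonneg T φ n (T x)
      linarith
  have h2 := integral_mono (hi.sub hi') (hφi.indicator (hAm n)) h1
  rw [integral_indicator (hAm n)] at h2
  refine le_trans (le_of_eq ?_) h2
  rw [integral_sub' hi hi']
  have h3 : ∫ x, (maxBirkhoffSum T φ n ∘ T) x ∂μ = ∫ x, maxBirkhoffSum T φ n x ∂μ := by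
    have := integral_map (μ := μ) hT.measurable.aemeasurable
      (f := maxBirkhoffSum T φ n) (by rw [hT.map_eq]; exact hi.aestronglyMeasurable)
    rw [hT.map_eq] at this
    exact this.symm
  rw [h3, sub_self]

theorem condExp_invariants_comp_eq {E : Type*} [NormedAddCommGroup E] [NormedSpace ℝ E]
    [CompleteSpace E] (T : Y → Y) (f : Y → E) (x : Y) :
    (μ[f | MeasurableSpace.invariants T]) (T x) = (μ[f | MeasurableSpace.invariants T]) x := by
  borelize E
  exact congrFun (MeasurableSpace.comp_eq_of_measurable_invariants
    (stronglyMeasurable_condExp (m := MeasurableSpace.invariants T) (f := f)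
      (μ := μ)).measurable) x

/-- Passing from `q` to `q + 1` frees a slack linear in `n`, which absorbs the bounded difference.
This makes the bad set of the next theorem exactly invariant. -/
theorem exists_frequently_lt_of_abs_sub_le {u w : ℕ → ℝ} {K c : ℝ}
    (huw : ∀ n, |u n - w n| ≤ K)
    (h : ∃ q : ℕ, ∃ᶠ n : ℕ in atTop, (c + 1 / (q + 1 : ℝ)) * n < u n) :
    ∃ q : ℕ, ∃ᶠ n : ℕ in atTop, (c + 1 / (q + 1 : ℝ)) * n < w n := by
  obtain ⟨q, hq⟩ := h
  refine ⟨q + 1, (hq.and_eventually ((tendsto_natCast_atTop_atTop (R := ℝ)).eventually_ge_atTop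
    (K * ((q + 1) * (q + 2))))).mono ?_⟩
  rintro n ⟨h1, h2⟩
  have h3 := (abs_le.1 (huw n)).2
  have h4 : K ≤ (1 / (q + 1 : ℝ) - 1 / ((q + 1 : ℕ) + 1 : ℝ)) * n := by
    have : (1 / (q + 1 : ℝ) - 1 / ((q + 1 : ℕ) + 1 : ℝ)) = 1 / ((q + 1) * (q + 2)) := by
      push_cast; field_simp; ring
    rw [this, one_div, inv_mul_eq_div, le_div_iff₀ (by positivity)]
    exact h2
  nlinarith

/-- On the invariant set `E` of points whose averages exceed `F + δ` by a fixed amount infinitely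
often, `f - F - δ` has a positive Birkhoff sum. The maximal theorem makes its integral over `E`
nonnegative, yet this integral is `-δ * μ E`, as `F` and `f` have equal integrals over invariant
sets. -/
theorem ae_eventually_birkhoffSum_le [IsProbabilityMeasure μ] {T : Y → Y}
    (hT : MeasurePreserving T μ μ) {f : Y → ℝ} (hf : Measurable f) {C : ℝ}
    (hC : ∀ x, |f x| ≤ C) {ε : ℝ} (hε : 0 < ε) :
    ∀ᵐ x ∂μ, ∀ᶠ n : ℕ in atTop, birkhoffSum T f n x
      ≤ ((μ[f | MeasurableSpace.invariants T]) x + ε) * n := by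
  set F := μ[f | MeasurableSpace.invariants T] with hF
  have hle := MeasurableSpace.invariants_le T
  have hfi : Integrable f μ := Integrable.of_bound hf.aestronglyMeasurable C
    (Eventually.of_forall hC)
  have hFm : Measurable F :=
    (stronglyMeasurable_condExp (m := MeasurableSpace.invariants T)).measurable.mono hle le_rfl
  have hFi : Integrable F μ := integrable_condExp
  have hFT : ∀ x, F (T x) = F x := fun x => condExp_invariants_comp_eq T f x
  have hSm : ∀ n, Measurable (birkhoffSum T f n) := fun n =>
    Finset.measurable_fun_sum _ fun k _ => hf.comp (hT.measurable.iterate k)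
  set δ := ε / 2 with hδ
  set E : Set Y := {x | ∃ q : ℕ, ∃ᶠ n : ℕ in atTop,
    (F x + δ + 1 / (q + 1 : ℝ)) * n < birkhoffSum T f n x} with hE
  have hEm : MeasurableSet E := by
    have : E = ⋃ q : ℕ, ⋂ N : ℕ, ⋃ n : ℕ, ⋃ _ : N ≤ n,
        {x | (F x + δ + 1 / (q + 1 : ℝ)) * n < birkhoffSum T f n x} := by
      ext x; simp [hE, frequently_atTop]
    rw [this]
    exact .iUnion fun q => .iInter fun N => .iUnion fun n => .iUnion fun _ =>
      measurableSet_lt (((hFm.add_const _).add_const _).mul_const _) (hSm n)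
  have hdiff : ∀ x n, |birkhoffSum T f n (T x) - birkhoffSum T f n x| ≤ 2 * C := by
    intro x n
    rw [birkhoffSum_apply_sub_birkhoffSum]
    exact (abs_sub _ _).trans (by linarith [hC (T^[n] x), hC x])
  have hEinv : T ⁻¹' E = E := by
    ext x
    simp only [hE, Set.mem_preimage, Set.mem_ofPred_eq, hFT]
    exact ⟨exists_frequently_lt_of_abs_sub_le (hdiff x),
      exists_frequently_lt_of_abs_sub_le fun n => by rw [abs_sub_comm]; exact hdiff x n⟩
  have hEI : MeasurableSet[MeasurableSpace.invariants T] E := ⟨hEm, hEinv⟩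
  have hmem : ∀ k x, T^[k] x ∈ E ↔ x ∈ E := by
    intro k
    induction k with
    | zero => exact fun x => Iff.rfl
    | succ k ih =>
      intro x
      rw [Function.iterate_succ_apply, ih]
      exact Set.ext_iff.1 hEinv x
  have hFk : ∀ k x, F (T^[k] x) = F x := by
    intro k
    induction k with
    | zero => exact fun x => rfl
    | succ k ih => intro x; rw [Function.iterate_succ_apply, ih, hFT]
  set φ : Y → ℝ := E.indicator fun x => f x - F x - δ with hφ
  have hi : Integrable (fun x => f x - F x - δ) μ := (hfi.sub hFi).sub (integrable_const δ)
  have hsumE : ∀ x ∈ E, ∀ n, birkhoffSum T φ n x = birkhoffSum T f n x - (F x + δ) * n := by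
    intro x hx n
    have : ∀ k, φ (T^[k] x) = f (T^[k] x) - (F x + δ) := fun k => by
      simp only [hφ]
      rw [Set.indicator_of_mem ((hmem k x).2 hx), hFk]; ring
    simp only [birkhoffSum, this, Finset.sum_sub_distrib]
    simp; ring
  have hsumE' : ∀ x ∉ E, ∀ n, birkhoffSum T φ n x = 0 := by
    intro x hx n
    refine Finset.sum_eq_zero fun k _ => ?_
    exact Set.indicator_of_notMem (fun h => hx ((hmem k x).1 h)) _
  have hset : {x | ∃ k, 0 < birkhoffSum T φ k x} = E := by
    ext x
    constructor
    · rintro ⟨k, hk⟩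
      by_contra hx
      rw [hsumE' x hx] at hk
      exact lt_irrefl _ hk
    · intro hx
      have hx' := hx
      obtain ⟨q, hq⟩ := hx'
      obtain ⟨n, hn⟩ := hq.exists
      refine ⟨n, ?_⟩
      rw [hsumE x hx]
      have : (0 : ℝ) ≤ 1 / (q + 1 : ℝ) * n := by positivity
      nlinarith
  have hmax := setIntegral_exists_birkhoffSum_pos_nonneg (φ := φ) hT
    (((hf.sub hFm).sub_const δ).indicator hEm) (hi.indicator hEm)
  rw [hset, hφ, setIntegral_indicator hEm, Set.inter_self,
    integral_sub (f := fun x => f x - F x) (hfi.sub hFi).integrableOn (integrable_const δ).integrableOn,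
    integral_sub hfi.integrableOn hFi.integrableOn, setIntegral_condExp hle hfi hEI] at hmax
  simp only [sub_self, zero_sub, integral_const, measureReal_restrict_apply_univ, smul_eq_mul,
    Left.nonneg_neg_iff] at hmax
  have hμE : μ E = 0 := by
    have h0 : μ.real E = 0 := le_antisymm (by
      have hδ0 : 0 < δ := by simp only [hδ]; linarith
      by_contra hcon
      exact absurd hmax (not_le.2 (mul_pos (not_le.1 hcon) hδ0))) measureReal_nonneg
    exact (measureReal_eq_zero_iff (measure_ne_top _ _)).1 h0
  obtain ⟨q, hq⟩ := exists_nat_one_div_lt (show 0 < δ by simp only [hδ]; linarith)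
  filter_upwards [measure_eq_zero_iff_ae_notMem.1 hμE] with x hx
  simp only [hE, Set.mem_ofPred_eq, not_exists, not_frequently, not_lt] at hx
  filter_upwards [hx q] with n hn
  refine hn.trans (mul_le_mul_of_nonneg_right ?_ (Nat.cast_nonneg n))
  simp only [hδ] at hq ⊢
  linarith

/-- The pointwise ergodic theorem for bounded real functions. -/
theorem ae_tendsto_birkhoffSum_div [IsProbabilityMeasure μ] {T : Y → Y}
    (hT : MeasurePreserving T μ μ) {f : Y → ℝ} (hf : Measurable f) {C : ℝ}
    (hC : ∀ x, |f x| ≤ C) :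
    ∀ᵐ x ∂μ, Tendsto (fun n : ℕ => birkhoffSum T f n x / n) atTop
      (𝓝 ((μ[f | MeasurableSpace.invariants T]) x)) := by
  have h1 : ∀ q : ℕ, _ := fun q => ae_eventually_birkhoffSum_le hT hf hC
    (Nat.one_div_pos_of_nat (n := q) (α := ℝ))
  have h2 : ∀ q : ℕ, _ := fun q => ae_eventually_birkhoffSum_le hT hf.neg
    (f := -f) (C := C) (by simpa using hC) (Nat.one_div_pos_of_nat (n := q) (α := ℝ))
  filter_upwards [ae_all_iff.2 h1, ae_all_iff.2 h2,
    condExp_neg (μ := μ) f (MeasurableSpace.invariants T)] with x hx1 hx2 hn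
  rw [Metric.tendsto_atTop']
  intro ε hε
  obtain ⟨q, hq⟩ := exists_nat_one_div_lt hε
  obtain ⟨N, hN⟩ := eventually_atTop.1 ((hx1 q).and (hx2 q))
  refine ⟨N, fun n hnN => ?_⟩
  obtain ⟨a1, a2⟩ := hN n hnN.le
  have hn0 : (0 : ℝ) < n := by exact_mod_cast (Nat.zero_le N).trans_lt hnN
  rw [hn, birkhoffSum_neg] at a2
  simp only [Pi.neg_apply] at a2
  rw [Real.dist_eq, abs_lt]
  constructor
  · rw [lt_sub_iff_add_lt, lt_div_iff₀ hn0]; nlinarith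
  · rw [sub_lt_iff_lt_add, div_lt_iff₀ hn0]; nlinarith

/-- The pointwise ergodic theorem for bounded complex functions. -/
theorem ae_tendsto_birkhoffSum_div_complex [IsProbabilityMeasure μ] {T : Y → Y}
    (hT : MeasurePreserving T μ μ) {f : Y → ℂ} (hf : Measurable f) {C : ℝ}
    (hC : ∀ x, ‖f x‖ ≤ C) :
    ∀ᵐ x ∂μ, Tendsto (fun n : ℕ => birkhoffSum T f n x / n) atTop
      (𝓝 ((μ[f | MeasurableSpace.invariants T]) x)) := by
  have hle := MeasurableSpace.invariants_le T
  have hfi : Integrable f μ := Integrable.of_bound hf.aestronglyMeasurable C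
    (Eventually.of_forall hC)
  filter_upwards [Complex.reCLM.comp_condExp_comm hfi (m := MeasurableSpace.invariants T),
    Complex.imCLM.comp_condExp_comm hfi (m := MeasurableSpace.invariants T),
    ae_tendsto_birkhoffSum_div hT (Complex.measurable_re.comp hf) (C := C)
      (fun x => (Complex.abs_re_le_norm _).trans (hC x)),
    ae_tendsto_birkhoffSum_div hT (Complex.measurable_im.comp hf) (C := C)
      (fun x => (Complex.abs_im_le_norm _).trans (hC x))] with x h1 h2 h3 h4
  have h := (Complex.continuous_ofReal.tendsto _).comp h3 |>.add
    (((Complex.continuous_ofReal.tendsto _).comp h4).mul_const Complex.I)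
  have e1 : (μ[Complex.re ∘ f | MeasurableSpace.invariants T]) x
      = ((μ[f | MeasurableSpace.invariants T]) x).re := h1.symm
  have e2 : (μ[Complex.im ∘ f | MeasurableSpace.invariants T]) x
      = ((μ[f | MeasurableSpace.invariants T]) x).im := h2.symm
  rw [e1, e2, Complex.re_add_im] at h
  refine h.congr fun n => ?_
  simp only [Function.comp_apply, birkhoffSum]
  apply Complex.ext <;> simp
end Birkhoff

/-! ### Averages with decreasing weights -/

theorem exists_pow_le_lt {d : ℕ} (hd : d ≠ 0) {J N : ℕ} (hJ : J ^ d ≤ N) :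
    ∃ j, J ≤ j ∧ j ^ d ≤ N ∧ N < (j + 1) ^ d := by
  have hle : ∀ j, j ≤ j ^ d := fun j => Nat.le_self_pow hd j
  refine ⟨Nat.findGreatest (fun j => j ^ d ≤ N) N,
    Nat.le_findGreatest ((hle J).trans hJ) hJ,
    Nat.findGreatest_spec (P := fun j => j ^ d ≤ N) ((hle J).trans hJ) hJ, ?_⟩
  by_contra! h
  have := Nat.le_findGreatest (P := fun j => j ^ d ≤ N) ((hle _).trans h) h
  omega

section Weighted

variable {τ : ℕ → ℝ}

theorem sum_range_pos_of_pos (hpos : ∀ k, 0 < τ k) {N : ℕ} (hN : 0 < N) :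
    0 < ∑ k ∈ Finset.range N, τ k :=
  Finset.sum_pos (fun k _ => hpos k) (by simpa using hN.ne')

/-- The averages of an antitone sequence decrease. -/
theorem sum_range_div_le_of_antitone (hpos : ∀ k, 0 < τ k) (hanti : Antitone τ) {m n : ℕ}
    (hm : 0 < m) (hmn : m ≤ n) :
    (∑ k ∈ Finset.range n, τ k) / ∑ k ∈ Finset.range m, τ k ≤ n / m := by
  have hm' : (0 : ℝ) < m := by exact_mod_cast hm
  have h1 : (m : ℝ) * τ m ≤ ∑ k ∈ Finset.range m, τ k := by
    calc (m : ℝ) * τ m = ∑ k ∈ Finset.range m, τ m := by simp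
      _ ≤ _ := Finset.sum_le_sum fun k hk => hanti (Finset.mem_range.1 hk).le
  have h2 : ∑ k ∈ Finset.range n, τ k ≤ ∑ k ∈ Finset.range m, τ k + (n - m : ℝ) * τ m := by
    rw [← Finset.sum_range_add_sum_Ico τ hmn]
    gcongr
    calc _ ≤ ∑ k ∈ Finset.Ico m n, τ m :=
          Finset.sum_le_sum fun k hk => hanti (Finset.mem_Ico.1 hk).1
      _ = _ := by simp [Nat.cast_sub hmn]
  rw [div_le_div_iff₀ (sum_range_pos_of_pos hpos hm) hm']
  have h3 : (0 : ℝ) ≤ n - m := by rw [sub_nonneg]; exact_mod_cast hmn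
  nlinarith

theorem tendsto_succ_pow_div_pow (d : ℕ) :
    Tendsto (fun j : ℕ => (((j + 1) ^ d : ℕ) : ℝ) / ((j ^ d : ℕ) : ℝ)) atTop (𝓝 1) := by
  have h : Tendsto (fun j : ℕ => 1 + 1 / (j : ℝ)) atTop (𝓝 1) := by
    simpa using tendsto_one_div_atTop_nhds_zero_nat (𝕜 := ℝ).const_add 1
  have h2 := h.pow d
  rw [one_pow] at h2
  refine h2.congr' ?_
  filter_upwards [eventually_gt_atTop 0] with j hj
  have hj' : (j : ℝ) ≠ 0 := by positivity
  push_cast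
  rw [← div_pow]
  congr 1
  field_simp

theorem tendsto_sum_range_succ_pow_div (hpos : ∀ k, 0 < τ k) (hanti : Antitone τ) (d : ℕ) :
    Tendsto (fun j : ℕ => (∑ k ∈ Finset.range ((j + 1) ^ d), τ k) /
      ∑ k ∈ Finset.range (j ^ d), τ k) atTop (𝓝 1) := by
  refine tendsto_of_tendsto_of_tendsto_of_le_of_le' tendsto_const_nhds
    (tendsto_succ_pow_div_pow d) ?_ ?_
  · filter_upwards [eventually_gt_atTop 0] with j hj
    rw [le_div_iff₀ (sum_range_pos_of_pos hpos (by positivity)), one_mul]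
    exact Finset.sum_le_sum_of_subset_of_nonneg
      (Finset.range_mono (Nat.pow_le_pow_left (Nat.le_succ j) d)) fun k _ _ => (hpos k).le
  · filter_upwards [eventually_gt_atTop 0] with j hj
    exact sum_range_div_le_of_antitone hpos hanti (by positivity)
      (Nat.pow_le_pow_left (Nat.le_succ j) d)

/-- Convergence of weighted averages along `j ^ d` implies convergence along all integers. -/
theorem tendsto_sum_div_of_tendsto_pow {b : ℕ → ℕ} (hpos : ∀ k, 0 < τ k) (hanti : Antitone τ)
    {d : ℕ} (hd : d ≠ 0) {u : ℕ → ℂ} (hu : ∀ k, ‖u k‖ ≤ b k + τ k)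
    (hs : Tendsto (fun j : ℕ => (partialCount b (j ^ d) : ℝ) / ∑ k ∈ Finset.range (j ^ d), τ k)
      atTop (𝓝 1))
    (hU : Tendsto (fun j : ℕ => ‖∑ k ∈ Finset.range (j ^ d), u k‖ /
      ∑ k ∈ Finset.range (j ^ d), τ k) atTop (𝓝 0)) :
    Tendsto (fun N : ℕ => ‖∑ k ∈ Finset.range N, u k‖ / ∑ k ∈ Finset.range N, τ k)
      atTop (𝓝 0) := by
  set W : ℕ → ℝ := fun N => ∑ k ∈ Finset.range N, τ k with hW
  have hWmono : Monotone W := fun m n h =>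
    Finset.sum_le_sum_of_subset_of_nonneg (Finset.range_mono h) fun k _ _ => (hpos k).le
  have hr : Tendsto (fun j : ℕ => W ((j + 1) ^ d) / W (j ^ d)) atTop (𝓝 1) :=
    tendsto_sum_range_succ_pow_div hpos hanti d
  have hs' := (tendsto_add_atTop_iff_nat 1).2 hs
  -- This bounds the cost of moving from `j ^ d` to any `N < (j + 1) ^ d`: the mass of `b + τ` in
  -- between, relative to `W (j ^ d)`, tends to `0`.
  have hE := (hU.add ((hs'.mul hr).sub hs)).add (hr.sub_const 1)
  simp only [mul_one, sub_self, add_zero] at hE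
  rw [Metric.tendsto_atTop] at hE ⊢
  intro ε hε
  obtain ⟨J, hJ⟩ := hE ε hε
  refine ⟨(J + 1) ^ d, fun N hN => ?_⟩
  obtain ⟨j, hj, hjN, hNj⟩ := exists_pow_le_lt hd hN
  have hW0 : 0 < W (j ^ d) := sum_range_pos_of_pos hpos (Nat.pow_pos (by omega))
  have hWN : W (j ^ d) ≤ W N := hWmono hjN
  have hWj : 0 < W ((j + 1) ^ d) := sum_range_pos_of_pos hpos (by positivity)
  have h := hJ j (by omega)
  have hb : ‖∑ k ∈ Finset.range N, u k‖ ≤ ‖∑ k ∈ Finset.range (j ^ d), u k‖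
      + ((partialCount b ((j + 1) ^ d) : ℝ) - partialCount b (j ^ d))
      + (W ((j + 1) ^ d) - W (j ^ d)) := by
    have e1 := Finset.sum_range_add_sum_Ico u hjN
    have e2 := Finset.sum_range_add_sum_Ico τ (hjN.trans hNj.le)
    have e3 := Finset.sum_range_add_sum_Ico b (hjN.trans hNj.le)
    rw [← e1]
    refine (norm_add_le _ _).trans ?_
    rw [add_assoc]
    gcongr
    calc _ ≤ ∑ k ∈ Finset.Ico (j ^ d) N, ((b k : ℝ) + τ k) :=
          (norm_sum_le _ _).trans (Finset.sum_le_sum fun k _ => hu k)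
      _ ≤ ∑ k ∈ Finset.Ico (j ^ d) ((j + 1) ^ d), ((b k : ℝ) + τ k) :=
          Finset.sum_le_sum_of_subset_of_nonneg (Finset.Ico_subset_Ico_right hNj.le)
            fun k _ _ => add_nonneg (Nat.cast_nonneg _) (hpos k).le
      _ = _ := by
          rw [Finset.sum_add_distrib]
          simp only [hW, partialCount]
          rw [← e2, ← e3]
          push_cast; ring
  rw [Real.dist_eq, sub_zero, abs_of_nonneg (by have := hW0.trans_le hWN; positivity)]
  rw [Real.dist_eq, sub_zero] at h
  refine lt_of_le_of_lt ?_ ((le_abs_self _).trans_lt h)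
  calc _ ≤ (‖∑ k ∈ Finset.range (j ^ d), u k‖
      + ((partialCount b ((j + 1) ^ d) : ℝ) - partialCount b (j ^ d))
      + (W ((j + 1) ^ d) - W (j ^ d))) / W N :=
        div_le_div_of_nonneg_right hb (hW0.trans_le hWN).le
    _ ≤ (‖∑ k ∈ Finset.range (j ^ d), u k‖
      + ((partialCount b ((j + 1) ^ d) : ℝ) - partialCount b (j ^ d))
      + (W ((j + 1) ^ d) - W (j ^ d))) / W (j ^ d) :=
        div_le_div_of_nonneg_left ((norm_nonneg _).trans hb) hW0 hWN
    _ = _ := by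
        simp only [hW] at hW0 hWj ⊢
        field_simp

/-- Abel summation, run as an induction that keeps the boundary term at `N`. -/
theorem sum_mul_le_of_sum_le (hpos : ∀ k, 0 < τ k) (hanti : Antitone τ) {u : ℕ → ℝ} {c C : ℝ}
    (hu : ∀ N : ℕ, ∑ k ∈ Finset.range N, u k ≤ c * N + C) (N : ℕ) :
    ∑ k ∈ Finset.range N, τ k * u k ≤ c * ∑ k ∈ Finset.range N, τ k + C * τ 0 := by
  suffices h : ∑ k ∈ Finset.range N, τ k * u k - c * ∑ k ∈ Finset.range N, τ k
      ≤ τ N * (∑ k ∈ Finset.range N, u k - c * N - C) + C * τ 0 by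
    have : τ N * (∑ k ∈ Finset.range N, u k - c * N - C) ≤ 0 :=
      mul_nonpos_of_nonneg_of_nonpos (hpos N).le (by linarith [hu N])
    linarith
  induction N with
  | zero => simp; linarith
  | succ N ih =>
    have h1 := hu (N + 1)
    have h2 := hanti (Nat.le_succ N)
    rw [Finset.sum_range_succ] at h1
    simp only [Finset.sum_range_succ]
    push_cast at h1 ⊢
    nlinarith

theorem norm_sum_mul_sub_succ_le (c h : ℕ → ℂ) {H : ℝ} (hH : ∀ k, ‖h k‖ ≤ H) (N : ℕ) :
    ‖∑ k ∈ Finset.range N, c k * (h k - h (k + 1))‖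
      ≤ H * (‖c 0‖ + ‖c N‖ + ∑ k ∈ Finset.range N, ‖c (k + 1) - c k‖) := by
  have e : ∑ k ∈ Finset.range N, c k * (h k - h (k + 1))
      = c 0 * h 0 - c N * h N + ∑ k ∈ Finset.range N, (c (k + 1) - c k) * h (k + 1) := by
    induction N with
    | zero => simp
    | succ N ih => rw [Finset.sum_range_succ, ih, Finset.sum_range_succ]; ring
  have hb : ∀ (z : ℂ) k, ‖z * h k‖ ≤ H * ‖z‖ := fun z k => by
    rw [norm_mul, mul_comm]; gcongr; exact hH k
  rw [e]
  calc _ ≤ H * ‖c 0‖ + H * ‖c N‖ + ∑ k ∈ Finset.range N, H * ‖c (k + 1) - c k‖ :=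
        (norm_add_le _ _).trans (add_le_add ((norm_sub_le _ _).trans (add_le_add (hb _ _) (hb _ _)))
          ((norm_sum_le _ _).trans (Finset.sum_le_sum fun k _ => hb _ _)))
    _ = _ := by rw [← Finset.mul_sum]; ring

/-- The factor `τ k` is small outside finitely many `k`, while the mass of `b` is comparable to that
of `τ`. -/
theorem tendsto_sum_mul_div_of_tendsto_zero {b : ℕ → ℕ} (hpos : ∀ k, 0 < τ k)
    (hanti : Antitone τ) (hτ0 : Tendsto τ atTop (𝓝 0))
    (hW : Tendsto (fun N => ∑ k ∈ Finset.range N, τ k) atTop atTop)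
    (hs : Tendsto (fun N : ℕ => (partialCount b N : ℝ) / ∑ k ∈ Finset.range N, τ k)
      atTop (𝓝 1)) :
    Tendsto (fun N : ℕ => (∑ k ∈ Finset.range N, τ k * b k) / ∑ k ∈ Finset.range N, τ k)
      atTop (𝓝 0) := by
  rw [Metric.tendsto_atTop]
  intro ε hε
  obtain ⟨K, hK⟩ := eventually_atTop.1 (hτ0.eventually_lt_const (show 0 < ε / 4 by positivity))
  have hbound : ∀ N, ∑ k ∈ Finset.range N, τ k * b k
      ≤ ε / 4 * partialCount b N + τ 0 * partialCount b K := by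
    intro N
    have e : ∀ M, (partialCount b M : ℝ) = ∑ k ∈ Finset.range M, (b k : ℝ) := fun M => by
      simp [partialCount]
    have h1 : ∀ k, τ k * b k ≤ ε / 4 * b k + if k < K then τ 0 * b k else 0 := by
      intro k
      have hb0 : (0 : ℝ) ≤ b k := Nat.cast_nonneg _
      split_ifs with hk
      · have := hanti (Nat.zero_le k)
        nlinarith
      · have := hK k (not_lt.1 hk)
        nlinarith
    refine (Finset.sum_le_sum fun k _ => h1 k).trans ?_
    rw [Finset.sum_add_distrib, ← Finset.mul_sum, ← e, e K, Finset.mul_sum]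
    gcongr
    rw [← Finset.sum_filter]
    refine Finset.sum_le_sum_of_subset_of_nonneg (fun k hk => ?_) fun k _ _ =>
      mul_nonneg (hpos 0).le (Nat.cast_nonneg _)
    simpa using (Finset.mem_filter.1 hk).2
  obtain ⟨N₁, hN₁⟩ := eventually_atTop.1 ((hs.eventually_lt_const (show (1 : ℝ) < 2 by norm_num)).and
    (((hW.eventually_gt_atTop 0)).and
      (hW.eventually_gt_atTop (τ 0 * partialCount b K / (ε / 4)))))
  refine ⟨N₁, fun N hN => ?_⟩
  obtain ⟨a1, a2, a3⟩ := hN₁ N hN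
  rw [Real.dist_eq, sub_zero, abs_of_nonneg (div_nonneg (Finset.sum_nonneg fun k _ =>
    mul_nonneg (hpos k).le (Nat.cast_nonneg _)) a2.le), div_lt_iff₀ a2]
  rw [div_lt_iff₀ a2] at a1
  rw [div_lt_iff₀ (by positivity)] at a3
  nlinarith [hbound N]

variable {b : ℕ → ℕ} {F : ℕ → ℂ} {CF : ℝ}

/-- Summation by parts moves the difference onto `τ k * F k`. The variation due to `τ` telescopes;
the jumps of `F` occur only where `b k = 1` and cost `τ k * b k`, which is negligible in total. -/
theorem tendsto_sum_mul_sub_succ (hb : ∀ k, b k ≤ 1) (hpos : ∀ k, 0 < τ k)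
    (hanti : Antitone τ) (hτ0 : Tendsto τ atTop (𝓝 0))
    (hW : Tendsto (fun N => ∑ k ∈ Finset.range N, τ k) atTop atTop)
    (hs : Tendsto (fun N : ℕ => (partialCount b N : ℝ) / ∑ k ∈ Finset.range N, τ k)
      atTop (𝓝 1))
    (hF : ∀ k, ‖F k‖ ≤ CF) (hFb : ∀ k, b k = 0 → F (k + 1) = F k)
    {q : ℕ → ℂ} {Cq : ℝ} (hq : ∀ k, ‖q k‖ ≤ Cq) :
    Tendsto (fun N : ℕ => ‖∑ k ∈ Finset.range N, τ k * F k * (q k - q (k + 1))‖ /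
      ∑ k ∈ Finset.range N, τ k) atTop (𝓝 0) := by
  have hCF : 0 ≤ CF := (norm_nonneg _).trans (hF 0)
  have hCq : 0 ≤ Cq := (norm_nonneg _).trans (hq 0)
  have hnorm : ∀ k, ‖(τ k : ℂ) * F k‖ ≤ τ k * CF := fun k => by
    rw [norm_mul, Complex.norm_real, Real.norm_of_nonneg (hpos k).le]
    exact mul_le_mul_of_nonneg_left (hF k) (hpos k).le
  have hstep : ∀ k, ‖(τ (k + 1) : ℂ) * F (k + 1) - τ k * F k‖
      ≤ CF * (τ k - τ (k + 1)) + 2 * CF * (τ k * b k) := by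
    intro k
    have h1 := hanti (Nat.le_succ k)
    have e : (τ (k + 1) : ℂ) * F (k + 1) - τ k * F k
        = τ k * (F (k + 1) - F k) - ((τ k - τ (k + 1) : ℝ) : ℂ) * F (k + 1) := by
      push_cast; ring
    have h2 : ‖F (k + 1) - F k‖ ≤ 2 * CF * b k := by
      have := hb k
      rcases (show b k = 0 ∨ b k = 1 by omega) with h | h
      · rw [hFb k h, h]; simp
      · rw [h]
        refine (norm_sub_le _ _).trans ?_
        have := hF k
        have := hF (k + 1)
        push_cast; linarith
    rw [e]
    refine (norm_sub_le _ _).trans ?_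
    rw [norm_mul, norm_mul, Complex.norm_real, Complex.norm_real,
      Real.norm_of_nonneg (hpos k).le, Real.norm_of_nonneg (sub_nonneg.2 h1)]
    have h3 := mul_le_mul_of_nonneg_left h2 (hpos k).le
    have h4 := mul_le_mul_of_nonneg_left (hF (k + 1)) (sub_nonneg.2 h1)
    nlinarith
  have hle : ∀ N, ‖∑ k ∈ Finset.range N, τ k * F k * (q k - q (k + 1))‖
      ≤ 3 * Cq * CF * τ 0 + 2 * Cq * CF * ∑ k ∈ Finset.range N, τ k * b k := by
    intro N
    refine (norm_sum_mul_sub_succ_le (fun k => τ k * F k) q hq N).trans ?_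
    have h1 := Finset.sum_le_sum fun k (_ : k ∈ Finset.range N) => hstep k
    rw [Finset.sum_add_distrib, ← Finset.mul_sum, ← Finset.mul_sum, Finset.sum_range_sub'] at h1
    have h2 := hnorm 0
    have h3 := hnorm N
    have h4 := mul_le_mul_of_nonneg_right (hanti (Nat.zero_le N)) hCF
    have h5 : 0 ≤ τ N * CF := mul_nonneg (hpos N).le hCF
    calc _ ≤ Cq * (3 * CF * τ 0 + 2 * CF * ∑ k ∈ Finset.range N, τ k * b k) := by
          refine mul_le_mul_of_nonneg_left ?_ hCq
          linarith
      _ = _ := by ring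
  have hlim : Tendsto (fun N : ℕ => 3 * Cq * CF * τ 0 / (∑ k ∈ Finset.range N, τ k)
      + 2 * Cq * CF * ((∑ k ∈ Finset.range N, τ k * b k) / ∑ k ∈ Finset.range N, τ k))
      atTop (𝓝 0) := by
    have := (hW.const_div_atTop (3 * Cq * CF * τ 0)).add
      ((tendsto_sum_mul_div_of_tendsto_zero hpos hanti hτ0 hW hs).const_mul (2 * Cq * CF))
    simpa using this
  have hW0 : ∀ N, 0 ≤ ∑ k ∈ Finset.range N, τ k := fun N =>
    Finset.sum_nonneg fun k _ => (hpos k).le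
  refine squeeze_zero (fun N => div_nonneg (norm_nonneg _) (hW0 N)) (fun N => ?_) hlim
  rw [← mul_div_assoc, ← add_div]
  exact div_le_div_of_nonneg_right (hle N) (hW0 N)

theorem tendsto_sum_mul_sub_add (hb : ∀ k, b k ≤ 1) (hpos : ∀ k, 0 < τ k)
    (hanti : Antitone τ) (hτ0 : Tendsto τ atTop (𝓝 0))
    (hW : Tendsto (fun N => ∑ k ∈ Finset.range N, τ k) atTop atTop)
    (hs : Tendsto (fun N : ℕ => (partialCount b N : ℝ) / ∑ k ∈ Finset.range N, τ k)
      atTop (𝓝 1))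
    (hF : ∀ k, ‖F k‖ ≤ CF) (hFb : ∀ k, b k = 0 → F (k + 1) = F k)
    {q : ℕ → ℂ} {Cq : ℝ} (hq : ∀ k, ‖q k‖ ≤ Cq) (i : ℕ) :
    Tendsto (fun N : ℕ => ‖∑ k ∈ Finset.range N, τ k * F k * (q k - q (k + i))‖ /
      ∑ k ∈ Finset.range N, τ k) atTop (𝓝 0) := by
  have hW0 : ∀ N, 0 ≤ ∑ k ∈ Finset.range N, τ k := fun N =>
    Finset.sum_nonneg fun k _ => (hpos k).le
  induction i with
  | zero => simp
  | succ i ih =>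
    have h1 := tendsto_sum_mul_sub_succ hb hpos hanti hτ0 hW hs hF hFb
      (q := fun k => q (k + i)) (fun k => hq (k + i))
    have h2 := ih.add h1
    rw [add_zero] at h2
    refine squeeze_zero (fun N => div_nonneg (norm_nonneg _) (hW0 N)) (fun N => ?_) h2
    rw [← add_div]
    refine div_le_div_of_nonneg_right (le_trans (le_of_eq ?_) (norm_add_le _ _)) (hW0 N)
    rw [← Finset.sum_add_distrib]
    congr 1
    refine Finset.sum_congr rfl fun k _ => ?_
    rw [show k + 1 + i = k + (i + 1) by ring]
    ring

theorem exists_forall_sum_le {u : ℕ → ℝ} {r c : ℝ} (hrc : r < c)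
    (hu : Tendsto (fun N : ℕ => (∑ k ∈ Finset.range N, u k) / N) atTop (𝓝 r)) :
    ∃ C, ∀ N : ℕ, ∑ k ∈ Finset.range N, u k ≤ c * N + C := by
  obtain ⟨K, hK⟩ := eventually_atTop.1 (hu.eventually_lt_const hrc)
  refine ⟨∑ M ∈ Finset.range (K + 1), |∑ k ∈ Finset.range M, u k - c * M|, fun N => ?_⟩
  rcases le_or_gt N K with h | h
  · have := Finset.single_le_sum (f := fun M : ℕ => |∑ k ∈ Finset.range M, u k - c * M|)
      (fun M _ => abs_nonneg _) (Finset.mem_range.2 (Nat.lt_succ_of_le h))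
    have h2 := le_abs_self (∑ k ∈ Finset.range N, u k - c * N)
    linarith
  · have h1 := hK N h.le
    have hN : (0 : ℝ) < N := by exact_mod_cast (Nat.zero_le K).trans_lt h
    rw [div_lt_iff₀ hN] at h1
    have : 0 ≤ ∑ M ∈ Finset.range (K + 1), |∑ k ∈ Finset.range M, u k - c * M| :=
      Finset.sum_nonneg fun M _ => abs_nonneg _
    linarith

/-- If `F` changes only where `b` is nonzero, then in weighted averages of `F k * q k` the sequence
`q` may be replaced by a constant which its short averages approximate well on average. -/
theorem tendsto_sum_mul_of_short_averages (hb : ∀ k, b k ≤ 1) (hpos : ∀ k, 0 < τ k)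
    (hanti : Antitone τ) (hτ0 : Tendsto τ atTop (𝓝 0))
    (hW : Tendsto (fun N => ∑ k ∈ Finset.range N, τ k) atTop atTop)
    (hs : Tendsto (fun N : ℕ => (partialCount b N : ℝ) / ∑ k ∈ Finset.range N, τ k)
      atTop (𝓝 1))
    (hF : ∀ k, ‖F k‖ ≤ CF) (hFb : ∀ k, b k = 0 → F (k + 1) = F k)
    {q : ℕ → ℂ} {Cq : ℝ} (hq : ∀ k, ‖q k‖ ≤ Cq) {φ γ : ℂ}
    (hφ : Tendsto (fun N : ℕ => (∑ k ∈ Finset.range N, τ k * F k) /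
      ((∑ k ∈ Finset.range N, τ k : ℝ) : ℂ)) atTop (𝓝 φ))
    (hγ : ∀ ε > 0, ∃ L : ℕ, 0 < L ∧ ∃ r < ε, Tendsto (fun N : ℕ =>
      (∑ k ∈ Finset.range N, ‖(∑ i ∈ Finset.range L, q (k + i)) / L - γ‖) / N) atTop (𝓝 r)) :
    Tendsto (fun N : ℕ => (∑ k ∈ Finset.range N, τ k * F k * q k) /
      ((∑ k ∈ Finset.range N, τ k : ℝ) : ℂ)) atTop (𝓝 (φ * γ)) := by
  have hCF : 0 ≤ CF := (norm_nonneg _).trans (hF 0)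
  set W : ℕ → ℝ := fun N => ∑ k ∈ Finset.range N, τ k with hWdef
  suffices h : Tendsto (fun N : ℕ => ‖∑ k ∈ Finset.range N, τ k * F k * (q k - γ)‖ / W N)
      atTop (𝓝 0) by
    have h1 : Tendsto (fun N : ℕ => (∑ k ∈ Finset.range N, τ k * F k * (q k - γ)) / (W N : ℂ))
        atTop (𝓝 0) := by
      rw [tendsto_zero_iff_norm_tendsto_zero]
      refine h.congr fun N => ?_
      rw [norm_div, Complex.norm_real,
        Real.norm_of_nonneg (Finset.sum_nonneg fun k _ => (hpos k).le)]
    have h2 := (hφ.mul_const γ).add h1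
    rw [add_zero] at h2
    refine h2.congr fun N => ?_
    rw [div_mul_eq_mul_div, ← add_div, Finset.sum_mul, ← Finset.sum_add_distrib]
    congr 1
    exact Finset.sum_congr rfl fun k _ => by ring
  rw [Metric.tendsto_atTop]
  intro ε hε
  -- The divisor contains `CF + 1` because `CF` may vanish.
  obtain ⟨L, hL, r, hr, hlim⟩ := hγ (ε / (4 * (CF + 1))) (by positivity)
  obtain ⟨C, hC⟩ := exists_forall_sum_le hr hlim
  have hL' : (L : ℂ) ≠ 0 := by exact_mod_cast hL.ne'
  have h1 : Tendsto (fun N : ℕ => ∑ i ∈ Finset.range L,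
      ‖∑ k ∈ Finset.range N, τ k * F k * (q k - q (k + i))‖ / W N) atTop (𝓝 0) := by
    simpa using tendsto_finsetSum (Finset.range L) fun i _ =>
      tendsto_sum_mul_sub_add hb hpos hanti hτ0 hW hs hF hFb hq i
  obtain ⟨N₁, hN₁⟩ := eventually_atTop.1 ((h1.eventually_lt_const
    (show 0 < ε / 4 by positivity)).and ((hW.eventually_gt_atTop 0).and
      (hW.eventually_gt_atTop (CF * (C * τ 0) / (ε / 4)))))
  refine ⟨N₁, fun N hN => ?_⟩
  obtain ⟨a1, a2, a3⟩ := hN₁ N hN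
  have a2' : 0 < W N := a2
  rw [Real.dist_eq, sub_zero, abs_of_nonneg (div_nonneg (norm_nonneg _) a2.le),
    div_lt_iff₀ a2']
  rw [div_lt_iff₀ (by positivity)] at a3
  rw [← Finset.sum_div, div_lt_iff₀ a2'] at a1
  -- Averaging over the shifts `i < L` replaces `q k` by a short average. The first sum is
  -- negligible by shift-insensitivity, the second by `hγ`, carried from uniform weights to `τ` by
  -- `sum_mul_le_of_sum_le`.
  have e : ∑ k ∈ Finset.range N, τ k * F k * (q k - γ)
      = (∑ i ∈ Finset.range L, ∑ k ∈ Finset.range N, τ k * F k * (q k - q (k + i))) / L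
        + ∑ k ∈ Finset.range N, τ k * F k * ((∑ i ∈ Finset.range L, q (k + i)) / L - γ) := by
    rw [Finset.sum_comm, Finset.sum_div, ← Finset.sum_add_distrib]
    refine Finset.sum_congr rfl fun k _ => ?_
    rw [← Finset.mul_sum, Finset.sum_sub_distrib]
    simp only [Finset.sum_const, Finset.card_range, nsmul_eq_mul]
    field_simp
    ring
  have b1 : ‖(∑ i ∈ Finset.range L, ∑ k ∈ Finset.range N, τ k * F k * (q k - q (k + i))) / L‖
      ≤ ∑ i ∈ Finset.range L, ‖∑ k ∈ Finset.range N, τ k * F k * (q k - q (k + i))‖ := by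
    rw [norm_div, Complex.norm_natCast]
    have : (1 : ℝ) ≤ L := by exact_mod_cast hL
    exact (div_le_self (norm_nonneg _) this).trans (norm_sum_le _ _)
  have b2 : ‖∑ k ∈ Finset.range N, τ k * F k * ((∑ i ∈ Finset.range L, q (k + i)) / L - γ)‖
      ≤ CF * (ε / (4 * (CF + 1)) * W N + C * τ 0) := by
    calc _ ≤ ∑ k ∈ Finset.range N,
            CF * (τ k * ‖(∑ i ∈ Finset.range L, q (k + i)) / L - γ‖) := by
          refine (norm_sum_le _ _).trans (Finset.sum_le_sum fun k _ => ?_)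
          rw [norm_mul, norm_mul, Complex.norm_real, Real.norm_of_nonneg (hpos k).le,
            mul_comm (τ k) ‖F k‖, mul_assoc]
          exact mul_le_mul_of_nonneg_right (hF k) (mul_nonneg (hpos k).le (norm_nonneg _))
      _ ≤ _ := by
          rw [← Finset.mul_sum]
          exact mul_le_mul_of_nonneg_left (sum_mul_le_of_sum_le hpos hanti hC N) hCF
  have b3 : CF * (ε / (4 * (CF + 1)) * W N) ≤ ε / 4 * W N := by
    have : CF * (ε / (4 * (CF + 1))) ≤ ε / 4 := by
      rw [mul_div_assoc', div_le_div_iff₀ (by positivity) (by norm_num)]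
      nlinarith
    nlinarith
  have a1' : ∑ i ∈ Finset.range L, ‖∑ k ∈ Finset.range N, τ k * F k * (q k - q (k + i))‖
      < ε / 4 * W N := a1
  have a3' : CF * (C * τ 0) < W N * (ε / 4) := a3
  have hpεW : 0 < ε * W N := by positivity
  rw [e]
  refine (norm_add_le _ _).trans_lt ?_
  nlinarith

end Weighted

/-! ### Selection probabilities and the counting function of a good selection -/

/-- The selection probabilities, indexed from `0`. -/
noncomputable def selectionProb (a : ℝ) (k : ℕ) : ℝ := ((k : ℝ) + 1) ^ (-a)

theorem selectionProb_pos (a : ℝ) (k : ℕ) : 0 < selectionProb a k := by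
  unfold selectionProb; positivity

theorem selectionProb_antitone {a : ℝ} (ha : 0 ≤ a) : Antitone (selectionProb a) := by
  intro m n h
  refine Real.rpow_le_rpow_of_nonpos (by positivity) ?_ (by linarith)
  gcongr

theorem selectionProb_le_one {a : ℝ} (ha : 0 ≤ a) (k : ℕ) : selectionProb a k ≤ 1 := by
  refine (selectionProb_antitone ha (Nat.zero_le k)).trans (le_of_eq ?_)
  simp [selectionProb]

theorem tendsto_selectionProb {a : ℝ} (ha : 0 < a) :
    Tendsto (selectionProb a) atTop (𝓝 0) :=
  (tendsto_rpow_neg_atTop ha).comp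
    (tendsto_atTop_add_const_right _ _ tendsto_natCast_atTop_atTop)

theorem rpow_le_sum_selectionProb {a : ℝ} (ha : 0 ≤ a) (N : ℕ) :
    (N : ℝ) * (N : ℝ) ^ (-a) ≤ ∑ k ∈ Finset.range N, selectionProb a k := by
  calc (N : ℝ) * (N : ℝ) ^ (-a) = ∑ k ∈ Finset.range N, (N : ℝ) ^ (-a) := by simp
    _ ≤ _ := Finset.sum_le_sum fun k hk =>
        Real.rpow_le_rpow_of_nonpos (by positivity)
          (by exact_mod_cast Nat.succ_le_of_lt (Finset.mem_range.1 hk)) (by linarith)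

theorem pow_rpow_le_sum_selectionProb {a : ℝ} (ha : 0 ≤ a) {j : ℕ} (hj : 0 < j) (d : ℕ) :
    (j : ℝ) ^ ((d : ℝ) - d * a) ≤ ∑ k ∈ Finset.range (j ^ d), selectionProb a k := by
  refine (le_of_eq ?_).trans (rpow_le_sum_selectionProb ha (j ^ d))
  have hj' : (0 : ℝ) < j := by exact_mod_cast hj
  push_cast
  rw [sub_eq_add_neg, Real.rpow_add hj', Real.rpow_natCast, ← Real.rpow_natCast_mul hj'.le]
  ring_nf

theorem tendsto_sum_selectionProb {a : ℝ} (ha : 0 ≤ a) (ha1 : a < 1) :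
    Tendsto (fun N => ∑ k ∈ Finset.range N, selectionProb a k) atTop atTop := by
  refine tendsto_atTop_mono' _ ?_ ((tendsto_rpow_atTop (sub_pos.2 ha1)).comp
    tendsto_natCast_atTop_atTop)
  filter_upwards [eventually_gt_atTop 0] with N hN
  have := pow_rpow_le_sum_selectionProb ha hN 1
  simpa using this

/-- The properties of the random selection `b` that the ergodic theorem needs. -/
structure IsGoodSelection (a : ℝ) (b : ℕ → ℕ) : Prop where
  le_one : ∀ k, b k ≤ 1
  bound : ∀ᶠ j : ℕ in atTop,
    CorrelationBound b (fun n => b n - selectionProb a n) (j ^ 48) (j ^ 8) (2 * j ^ 28) ∧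
      |∑ p ∈ Finset.range (j ^ 48), ((b p : ℝ) - selectionProb a p)| ≤ 2 * j ^ 28

namespace IsGoodSelection

variable {a : ℝ} {b : ℕ → ℕ}

theorem abs_sub_le_one (h : IsGoodSelection a b) (ha : 0 ≤ a) (k : ℕ) :
    |(b k : ℝ) - selectionProb a k| ≤ 1 := by
  have h1 : (b k : ℝ) ≤ 1 := by exact_mod_cast h.le_one k
  have h2 : (0 : ℝ) ≤ b k := Nat.cast_nonneg _
  have h3 := selectionProb_pos a k
  have h4 := selectionProb_le_one ha k
  rw [abs_le]; constructor <;> linarith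

theorem abs_sub_le_add (k : ℕ) :
    |(b k : ℝ) - selectionProb a k| ≤ b k + selectionProb a k := by
  have h2 : (0 : ℝ) ≤ b k := Nat.cast_nonneg _
  have h3 := selectionProb_pos a k
  rw [abs_le]; constructor <;> linarith

/-- The deviation is at most `2 * j ^ 28`, while the total weight is at least `j ^ (48 - 48 * a)`,
hence at least `j ^ 29`. -/
theorem tendsto_abs_sum_sub_div_pow (h : IsGoodSelection a b) (ha : 0 < a) (ha1 : a < 1 / 14) :
    Tendsto (fun j : ℕ => |∑ k ∈ Finset.range (j ^ 48), ((b k : ℝ) - selectionProb a k)| /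
      ∑ k ∈ Finset.range (j ^ 48), selectionProb a k) atTop (𝓝 0) := by
  have h0 : Tendsto (fun j : ℕ => 2 / (j : ℝ)) atTop (𝓝 0) :=
    tendsto_const_div_atTop_nhds_zero_nat 2
  refine squeeze_zero' (Eventually.of_forall fun j => div_nonneg (abs_nonneg _)
    (Finset.sum_nonneg fun k _ => (selectionProb_pos a k).le)) ?_ h0
  filter_upwards [h.bound, eventually_gt_atTop 0] with j hj hj0
  have hj1 : (1 : ℝ) ≤ j := by exact_mod_cast hj0
  have hW : (j : ℝ) ^ 29 ≤ ∑ k ∈ Finset.range (j ^ 48), selectionProb a k := by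
    refine le_trans ?_ (pow_rpow_le_sum_selectionProb ha.le hj0 48)
    rw [← Real.rpow_natCast]
    refine Real.rpow_le_rpow_of_exponent_le hj1 ?_
    push_cast; linarith
  calc _ ≤ 2 * (j : ℝ) ^ 28 / (j : ℝ) ^ 29 := by gcongr; exact hj.2
    _ = 2 / j := by field_simp

theorem tendsto_partialCount_div_sum (h : IsGoodSelection a b) (ha : 0 < a) (ha1 : a < 1 / 14) :
    Tendsto (fun N : ℕ => (partialCount b N : ℝ) / ∑ k ∈ Finset.range N, selectionProb a k)
      atTop (𝓝 1) := by
  have hpos := selectionProb_pos a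
  -- Used twice: along `j ^ 48`, to supply a hypothesis of the interpolation lemma, and then along
  -- all integers.
  have key : ∀ φ : ℕ → ℕ, (∀ᶠ j in atTop, 0 < φ j) →
      Tendsto (fun j => |∑ k ∈ Finset.range (φ j), ((b k : ℝ) - selectionProb a k)| /
        ∑ k ∈ Finset.range (φ j), selectionProb a k) atTop (𝓝 0) →
      Tendsto (fun j => (partialCount b (φ j) : ℝ) /
        ∑ k ∈ Finset.range (φ j), selectionProb a k) atTop (𝓝 1) := by
    intro φ hφ hlim
    have h1 : Tendsto (fun j => (∑ k ∈ Finset.range (φ j), ((b k : ℝ) - selectionProb a k)) /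
        ∑ k ∈ Finset.range (φ j), selectionProb a k) atTop (𝓝 0) := by
      rw [tendsto_zero_iff_abs_tendsto_zero]
      refine hlim.congr fun j => ?_
      simp only [Function.comp_apply]
      rw [abs_div, abs_of_nonneg (Finset.sum_nonneg fun k _ => (hpos k).le)]
    have h2 := h1.add_const 1
    rw [zero_add] at h2
    refine h2.congr' ?_
    filter_upwards [hφ] with j hj
    have := sum_range_pos_of_pos hpos hj
    rw [Finset.sum_sub_distrib, partialCount, Nat.cast_sum]
    field_simp
    ring
  refine key id (eventually_gt_atTop 0) ?_
  have hpow := h.tendsto_abs_sum_sub_div_pow ha ha1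
  have hs := key (fun j => j ^ 48)
    ((eventually_gt_atTop 0).mono fun j hj => by positivity) hpow
  have := tendsto_sum_div_of_tendsto_pow (b := b) hpos (selectionProb_antitone ha.le)
    (by norm_num : (48 : ℕ) ≠ 0)
    (u := fun k => (((b k : ℝ) - selectionProb a k : ℝ) : ℂ)) (fun k => by
      rw [Complex.norm_real]; exact abs_sub_le_add k) hs
    (hpow.congr fun j => by rw [← Complex.ofReal_sum, Complex.norm_real, Real.norm_eq_abs])
  exact this.congr fun N => by rw [← Complex.ofReal_sum, Complex.norm_real, Real.norm_eq_abs]; rfl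

theorem tendsto_partialCount (h : IsGoodSelection a b) (ha : 0 < a) (ha1 : a < 1 / 14) :
    Tendsto (partialCount b) atTop atTop := by
  have h1 := (h.tendsto_partialCount_div_sum ha ha1).pos_mul_atTop one_pos
    (tendsto_sum_selectionProb ha.le (by linarith))
  refine tendsto_natCast_atTop_iff.1 (h1.congr' ?_)
  filter_upwards [eventually_gt_atTop 0] with N hN
  exact div_mul_cancel₀ _ (sum_range_pos_of_pos (selectionProb_pos a) hN).ne'

end IsGoodSelection

/-! ### Ergodic averages along a good selection -/

theorem ae_tendsto_zero_of_summable_integral {Y : Type*} [MeasurableSpace Y] {μ : Measure Y}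
    {h : ℕ → Y → ℝ} (hm : ∀ j, Measurable (h j)) (h0 : ∀ j x, 0 ≤ h j x)
    (hi : ∀ j, Integrable (h j) μ) (hs : Summable fun j => ∫ x, h j x ∂μ) :
    ∀ᵐ x ∂μ, Tendsto (fun j => h j x) atTop (𝓝 0) := by
  have hfin : ∫⁻ x, ∑' j, ENNReal.ofReal (h j x) ∂μ ≠ ⊤ := by
    rw [lintegral_tsum fun j => (hm j).ennreal_ofReal.aemeasurable]
    simp_rw [← fun j => ofReal_integral_eq_lintegral_ofReal (hi j)
      (Eventually.of_forall (h0 j))]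
    exact hs.tsum_ofReal_ne_top
  filter_upwards [ae_lt_top' (AEMeasurable.tsum fun j =>
    (hm j).ennreal_ofReal.aemeasurable) hfin] with x hx
  have := ENNReal.tendsto_atTop_zero_of_tsum_ne_top hx.ne
  have h2 := (ENNReal.tendsto_toReal ENNReal.zero_ne_top).comp this
  simpa [Function.comp_def, ENNReal.toReal_ofReal (h0 _ x)] using h2

section System

theorem exists_measurable_bounded_ae_eq {Y : Type*} [MeasurableSpace Y] {μ : Measure Y}
    {f : Y → ℂ} (hf : MemLp f ⊤ μ) :
    ∃ f' : Y → ℂ, Measurable f' ∧ f =ᵐ[μ] f' ∧ ∃ C, ∀ x, ‖f' x‖ ≤ C := by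
  obtain ⟨h1, h2⟩ := hf
  rw [eLpNorm_exponent_top] at h2
  set C := (eLpNormEssSup f μ).toReal
  set F := h1.mk f
  have hFm : Measurable F := h1.stronglyMeasurable_mk.measurable
  refine ⟨fun x => if ‖F x‖ ≤ C then F x else 0,
    Measurable.ite (measurableSet_le hFm.norm measurable_const) hFm measurable_const, ?_,
    C, fun x => ?_⟩
  · filter_upwards [h1.ae_eq_mk, ae_le_eLpNormEssSup (f := f) (μ := μ)] with x hx hb
    have hb' : ‖f x‖ ≤ C := by
      rw [← toReal_enorm]
      exact ENNReal.toReal_mono h2.ne hb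
    rw [hx] at hb'
    rw [if_pos hb', hx]
  · simp only
    split_ifs with h
    · exact h
    · simp [C]

theorem birkhoffSum_apply_eq_sum_Icc {Y : Type*} (T : Y → Y) (f : Y → ℂ) (N : ℕ) (x : Y) :
    birkhoffSum T f N (T x) = ∑ n ∈ Finset.Icc 1 N, f (T^[n] x) := by
  induction N with
  | zero => simp
  | succ N ih =>
    rw [birkhoffSum_succ, ih, Finset.sum_Icc_succ_top (by omega), Function.iterate_succ_apply]

theorem sum_mul_partialCount_eq_birkhoffSum {b : ℕ → ℕ} (hb : ∀ k, b k ≤ 1) {Y : Type*} (T : Y → Y)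
    (f : Y → ℂ) (x : Y)
    (N : ℕ) : ∑ k ∈ Finset.range N, (b k : ℂ) * f (T^[partialCount b k] x)
      = birkhoffSum T f (partialCount b N) x := by
  induction N with
  | zero => simp [partialCount]
  | succ N ih =>
    rw [Finset.sum_range_succ, ih, partialCount_succ]
    have := hb N
    rcases (show b N = 0 ∨ b N = 1 by omega) with h | h
    · simp [h]
    · simp [h, birkhoffSum_succ]

variable {a : ℝ} {b : ℕ → ℕ} {Y : Type*} [MeasurableSpace Y] {μ : Measure Y}
  [IsProbabilityMeasure μ] {T S : Y → Y} {f g : Y → ℂ}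

/-- With `N = j ^ 48`, `M = j ^ 8` and `B = 2 * j ^ 28`, van der Corput bounds the mean square by
`26 * j ^ 88`, against a squared weight of at least `j ^ (96 - 96 * a)`. The ratio is summable when
`96 * a - 8 < -1`, that is `a < 7 / 96`, which `a < 1 / 14` ensures. -/
theorem ae_tendsto_norm_sum_centered_div (h : IsGoodSelection a b) (ha : 0 < a)
    (ha1 : a < 1 / 14) (hT : MeasurePreserving T μ μ) (hS : MeasurePreserving S μ μ)
    (hTS : Function.Commute T S) (hf : Measurable f) (hg : Measurable g)
    (hf1 : ∀ x, ‖f x‖ ≤ 1) (hg1 : ∀ x, ‖g x‖ ≤ 1) :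
    ∀ᵐ x ∂μ, Tendsto (fun N : ℕ => ‖∑ k ∈ Finset.range N,
      (((b k : ℝ) - selectionProb a k : ℝ) : ℂ) * (f (T^[partialCount b k] x) * g (S^[k] x))‖ /
        ∑ k ∈ Finset.range N, selectionProb a k) atTop (𝓝 0) := by
  have hpos := selectionProb_pos a
  set W : ℕ → ℝ := fun N => ∑ k ∈ Finset.range N, selectionProb a k with hW
  set v : ℕ → Y → ℂ := fun k x =>
    (((b k : ℝ) - selectionProb a k : ℝ) : ℂ) * (f (T^[partialCount b k] x) * g (S^[k] x)) with hv
  have hvm : ∀ k, Measurable (v k) := fun k =>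
    ((hf.comp (hT.measurable.iterate _)).mul (hg.comp (hS.measurable.iterate _))).const_mul _
  have hfg : ∀ k x, ‖f (T^[partialCount b k] x) * g (S^[k] x)‖ ≤ 1 := fun k x => by
    rw [norm_mul]; exact mul_le_one₀ (hf1 _) (norm_nonneg _) (hg1 _)
  have hv1 : ∀ k x, ‖v k x‖ ≤ 1 := fun k x => by
    simp only [hv]
    rw [norm_mul, Complex.norm_real]
    exact mul_le_one₀ (h.abs_sub_le_one ha.le k) (norm_nonneg _) (hfg k x)
  set H : ℕ → Y → ℝ := fun j x => (‖∑ k ∈ Finset.range (j ^ 48), v k x‖ / W (j ^ 48)) ^ 2 with hH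
  have hHm : ∀ j, Measurable (H j) := fun j =>
    ((Finset.measurable_fun_sum _ fun k _ => hvm k).norm.div_const _).pow_const 2
  have hHi : ∀ j, Integrable (H j) μ := fun j => by
    refine Integrable.of_bound (hHm j).aestronglyMeasurable
      ((((j ^ 48 : ℕ) : ℝ) / W (j ^ 48)) ^ 2) (Eventually.of_forall fun x => ?_)
    have hW0 : 0 ≤ W (j ^ 48) := Finset.sum_nonneg fun k _ => (hpos k).le
    rw [Real.norm_of_nonneg (sq_nonneg _)]
    refine pow_le_pow_left₀ (div_nonneg (norm_nonneg _) hW0)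
      (div_le_div_of_nonneg_right ((norm_sum_le _ _).trans ?_) hW0) 2
    simpa only [Finset.sum_const, Finset.card_range, nsmul_eq_mul, mul_one] using
      Finset.sum_le_sum fun k (_ : k ∈ Finset.range (j ^ 48)) => hv1 k x
  have hbound : ∀ᶠ j : ℕ in atTop, ∫ x, H j x ∂μ ≤ 26 * (j : ℝ) ^ (96 * a - 8) := by
    filter_upwards [h.bound, eventually_gt_atTop 0] with j hj hj0
    have hj1 : (1 : ℝ) ≤ j := by exact_mod_cast hj0
    have hcorr := integral_normSq_sum_le_of_correlations (μ := μ) hvm hv1 (j ^ 48) (j ^ 8)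
      (C := ((j ^ 8 : ℕ) + 1) * (2 * (2 * (j : ℝ) ^ 28))) (by positivity)
      (fun h' k hlt hk => norm_sum_correlation_le hT hS hTS hf hg hf1 hg1 h.le_one
        (y := fun n => (b n : ℝ) - selectionProb a n) hlt hk (by positivity)
        (fun l hl ψ => hj.1 h' k hlt hk l hl ψ))
    push_cast at hcorr
    have hI0 : ∫ x, ‖∑ k ∈ Finset.range (j ^ 48), v k x‖ ^ 2 ∂μ ≤ 26 * (j : ℝ) ^ 88 := by
      have h8 : (j : ℝ) ^ 8 + 1 ≤ 2 * (j : ℝ) ^ 8 := by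
        have : (1 : ℝ) ≤ (j : ℝ) ^ 8 := one_le_pow₀ hj1
        linarith
      have h32 : (j : ℝ) ^ 32 ≤ (j : ℝ) ^ 104 := pow_le_pow_right₀ hj1 (by norm_num)
      have h100 : (j : ℝ) ^ 100 ≤ (j : ℝ) ^ 104 := pow_le_pow_right₀ hj1 (by norm_num)
      have h2 : ((j : ℝ) ^ 8) ^ 2 * ∫ x, ‖∑ k ∈ Finset.range (j ^ 48), v k x‖ ^ 2 ∂μ
          ≤ ((j : ℝ) ^ 8) ^ 2 * (26 * (j : ℝ) ^ 88) := by
        refine hcorr.trans ?_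
        calc _ = 8 * (j : ℝ) ^ 32 + 2 * (j : ℝ) ^ 104
              + 8 * (j : ℝ) ^ 92 * ((j : ℝ) ^ 8 + 1) := by ring
          _ ≤ 8 * (j : ℝ) ^ 32 + 2 * (j : ℝ) ^ 104
              + 8 * (j : ℝ) ^ 92 * (2 * (j : ℝ) ^ 8) := by gcongr
          _ = 8 * (j : ℝ) ^ 32 + 2 * (j : ℝ) ^ 104 + 16 * (j : ℝ) ^ 100 := by ring
          _ ≤ 26 * (j : ℝ) ^ 104 := by linarith
          _ = _ := by ring
      exact le_of_mul_le_mul_left h2 (by positivity)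
    have hWj := pow_rpow_le_sum_selectionProb ha.le hj0 48
    have hj' : (0 : ℝ) < j := by linarith
    simp only [hH, div_pow]
    rw [integral_div]
    calc _ ≤ 26 * (j : ℝ) ^ 88 / ((j : ℝ) ^ (((48 : ℕ) : ℝ) - (48 : ℕ) * a)) ^ 2 := by gcongr
      _ = 26 * (j : ℝ) ^ (96 * a - 8) := by
          rw [← Real.rpow_natCast, ← Real.rpow_mul_natCast hj'.le, mul_div_assoc,
            ← Real.rpow_sub hj']
          congr 2
          push_cast; ring
  have hsum : Summable fun j => ∫ x, H j x ∂μ := by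
    refine Summable.of_norm_bounded_eventually_nat
      (g := fun j : ℕ => 26 * (j : ℝ) ^ (96 * a - 8))
      ((Real.summable_nat_rpow.2 (by linarith)).mul_left 26) ?_
    filter_upwards [hbound] with j hj
    rwa [Real.norm_of_nonneg (integral_nonneg fun x => sq_nonneg _)]
  have hpow : Tendsto (fun j : ℕ => (partialCount b (j ^ 48) : ℝ) / W (j ^ 48)) atTop (𝓝 1) :=
    (h.tendsto_partialCount_div_sum ha ha1).comp (tendsto_pow_atTop (by norm_num))
  filter_upwards [ae_tendsto_zero_of_summable_integral hHm (fun j x => sq_nonneg _) hHi hsum]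
    with x hx
  refine tendsto_sum_div_of_tendsto_pow (b := b) hpos (selectionProb_antitone ha.le)
    (by norm_num : (48 : ℕ) ≠ 0) (fun k => ?_) hpow ?_
  · rw [norm_mul, Complex.norm_real]
    exact (mul_le_of_le_one_right (norm_nonneg _) (hfg k x)).trans
      (IsGoodSelection.abs_sub_le_add k)
  · have h2 := (Real.continuous_sqrt.tendsto 0).comp hx
    rw [Real.sqrt_zero] at h2
    refine h2.congr fun j => ?_
    simp only [Function.comp_apply, hH]
    rw [Real.sqrt_sq (div_nonneg (norm_nonneg _) (Finset.sum_nonneg fun k _ => (hpos k).le))]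

theorem ae_tendsto_sum_centered_div (h : IsGoodSelection a b) (ha : 0 < a)
    (ha1 : a < 1 / 14) (hT : MeasurePreserving T μ μ) (hS : MeasurePreserving S μ μ)
    (hTS : Function.Commute T S) (hf : Measurable f) (hg : Measurable g) {C : ℝ} (hC : 0 < C)
    (hf1 : ∀ x, ‖f x‖ ≤ C) (hg1 : ∀ x, ‖g x‖ ≤ C) :
    ∀ᵐ x ∂μ, Tendsto (fun N : ℕ => (∑ k ∈ Finset.range N,
      (((b k : ℝ) - selectionProb a k : ℝ) : ℂ) * (f (T^[partialCount b k] x) * g (S^[k] x))) /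
        ((∑ k ∈ Finset.range N, selectionProb a k : ℝ) : ℂ)) atTop (𝓝 0) := by
  have hC' : (C : ℂ) ≠ 0 := by exact_mod_cast hC.ne'
  have hn : ∀ z : ℂ, ‖z‖ ≤ C → ‖z / C‖ ≤ 1 := fun z hz => by
    rw [norm_div, Complex.norm_real, Real.norm_of_nonneg hC.le, div_le_one hC]; exact hz
  filter_upwards [ae_tendsto_norm_sum_centered_div (f := fun x => f x / C) (g := fun x => g x / C)
    h ha ha1 hT hS hTS (hf.div_const _) (hg.div_const _) (fun x => hn _ (hf1 x))
    (fun x => hn _ (hg1 x))] with x hx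
  rw [tendsto_zero_iff_norm_tendsto_zero]
  have h2 := hx.const_mul (C ^ 2)
  rw [mul_zero] at h2
  refine h2.congr fun N => ?_
  rw [norm_div, Complex.norm_real,
    Real.norm_of_nonneg (Finset.sum_nonneg fun k _ => (selectionProb_pos a k).le),
    ← mul_div_assoc]
  congr 1
  rw [← Real.norm_of_nonneg (sq_nonneg C), ← Complex.norm_real, ← norm_mul, Finset.mul_sum]
  congr 1
  refine Finset.sum_congr rfl fun k _ => ?_
  push_cast
  field_simp

/-- The orbit averages of the error `d L` converge to its conditional expectation, whose integral `∫
d L` tends to `0` as `L → ∞`. So almost every `x` has an `L` for which this limit is small. -/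
theorem ae_exists_short_average (hS : MeasurePreserving S μ μ) (hg : Measurable g) {C : ℝ}
    (hC : 0 < C) (hg1 : ∀ x, ‖g x‖ ≤ C) :
    ∀ᵐ x ∂μ, ∀ ε > 0, ∃ L : ℕ, 0 < L ∧ ∃ r < ε, Tendsto (fun N : ℕ =>
      (∑ k ∈ Finset.range N, ‖(∑ i ∈ Finset.range L, g (S^[k + i] x)) / L
        - (μ[g | MeasurableSpace.invariants S]) x‖) / N) atTop (𝓝 r) := by
  set G := μ[g | MeasurableSpace.invariants S] with hG
  have hle := MeasurableSpace.invariants_le S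
  have hGm : Measurable G :=
    (stronglyMeasurable_condExp (m := MeasurableSpace.invariants S)).measurable.mono hle le_rfl
  have hGS : ∀ k x, G (S^[k] x) = G x := by
    intro k
    induction k with
    | zero => exact fun x => rfl
    | succ k ih => intro x; rw [Function.iterate_succ_apply, ih, hG, condExp_invariants_comp_eq]
  have hav : ∀ (L : ℕ) x, ‖(∑ i ∈ Finset.range L, g (S^[i] x)) / L‖ ≤ C := by
    intro L x
    rcases Nat.eq_zero_or_pos L with rfl | hL
    · simpa using hC.le
    · have hL' : (0 : ℝ) < L := by exact_mod_cast hL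
      rw [norm_div, Complex.norm_natCast, div_le_iff₀ hL']
      refine (norm_sum_le _ _).trans ?_
      calc _ ≤ ∑ i ∈ Finset.range L, C := Finset.sum_le_sum fun i _ => hg1 _
        _ = _ := by simp; ring
  have hBirk := ae_tendsto_birkhoffSum_div_complex hS hg hg1
  have hGC : ∀ᵐ x ∂μ, ‖G x‖ ≤ C := by
    filter_upwards [hBirk] with x hx
    exact le_of_tendsto hx.norm (Eventually.of_forall fun L => hav L x)
  -- The bound on `G` holds only almost everywhere; truncating at `2 * C` keeps `d L` bounded
  -- everywhere, and is inactive where that bound holds.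
  set d : ℕ → Y → ℝ := fun L x =>
    min ‖(∑ i ∈ Finset.range L, g (S^[i] x)) / L - G x‖ (2 * C) with hd
  have hdm : ∀ L, Measurable (d L) := fun L =>
    (((Finset.measurable_fun_sum _ fun i _ => hg.comp (hS.measurable.iterate i)).div_const _).sub
      hGm).norm.min measurable_const
  have hd0 : ∀ L x, 0 ≤ d L x := fun L x => le_min (norm_nonneg _) (by linarith)
  have hdC : ∀ L x, |d L x| ≤ 2 * C := fun L x => by
    rw [abs_of_nonneg (hd0 L x)]; exact min_le_right _ _
  have hlim : Tendsto (fun L => ∫ x, d L x ∂μ) atTop (𝓝 0) := by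
    have := tendsto_integral_of_dominated_convergence (F := d) (f := fun _ => (0 : ℝ)) (μ := μ)
      (fun _ => 2 * C) (fun L => (hdm L).aestronglyMeasurable) (integrable_const _)
      (fun L => Eventually.of_forall (hdC L)) (by
        filter_upwards [hBirk] with x hx
        have h1 : Tendsto (fun L : ℕ => ‖(∑ i ∈ Finset.range L, g (S^[i] x)) / L - G x‖)
            atTop (𝓝 0) := tendsto_iff_norm_sub_tendsto_zero.1 hx
        exact squeeze_zero (fun L => hd0 L x) (fun L => min_le_left _ _) h1)
    simpa using this
  have hR0 : ∀ L, 0 ≤ᵐ[μ] μ[d L | MeasurableSpace.invariants S] := fun L =>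
    condExp_nonneg (Eventually.of_forall (hd0 L))
  have hsmall : ∀ q : ℕ, ∀ᵐ x ∂μ, ∃ L : ℕ, 0 < L ∧
      (μ[d L | MeasurableSpace.invariants S]) x < 1 / (q + 1 : ℝ) := by
    intro q
    have hq : (0 : ℝ) < 1 / (q + 1 : ℝ) := by positivity
    rw [ae_iff]
    set B := {x | ¬∃ L : ℕ, 0 < L ∧
      (μ[d L | MeasurableSpace.invariants S]) x < 1 / (q + 1 : ℝ)} with hB
    -- Markov's inequality: `B` lies in the exceedance set of every `L > 0`, so letting `L → ∞`
    -- gives measure `0`.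
    have hle2 : ∀ L : ℕ, 0 < L → 1 / (q + 1 : ℝ) * μ.real B ≤ ∫ x, d L x ∂μ := by
      intro L hL
      rw [← integral_condExp hle (f := d L)]
      refine le_trans ?_ (mul_meas_ge_le_integral_of_nonneg (hR0 L)
        integrable_condExp (1 / (q + 1 : ℝ)))
      gcongr
      · exact measure_ne_top _ _
      · intro x hx
        simp only [hB, Set.mem_ofPred_eq, not_exists, not_and, not_lt] at hx
        exact hx L hL
    have hzero : 1 / (q + 1 : ℝ) * μ.real B ≤ 0 :=
      ge_of_tendsto hlim ((eventually_gt_atTop 0).mono hle2)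
    have : μ.real B = 0 := le_antisymm (by
      by_contra hcon
      exact absurd hzero (not_le.2 (mul_pos hq (not_le.1 hcon)))) measureReal_nonneg
    exact (measureReal_eq_zero_iff (measure_ne_top _ _)).1 this
  have hBd : ∀ L, _ := fun L => ae_tendsto_birkhoffSum_div hS (hdm L) (hdC L)
  filter_upwards [ae_all_iff.2 hsmall, ae_all_iff.2 hBd, hGC] with x h1 h2 h3 ε hε
  obtain ⟨q, hq⟩ := exists_nat_one_div_lt hε
  obtain ⟨L, hL, hLq⟩ := h1 q
  refine ⟨L, hL, _, hLq.trans hq, (h2 L).congr fun N => ?_⟩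
  congr 1
  refine Finset.sum_congr rfl fun k _ => ?_
  simp only [hd]
  rw [hGS, min_eq_left]
  · simp only [← Function.iterate_add_apply, add_comm]
  · exact (norm_sub_le _ _).trans (by linarith [hav L (S^[k] x)])

/-- The centred estimate with `g = 1` turns the Birkhoff averages of `f` into averages weighted by
`τ`; short averages then bring in `g`, and the centred estimate with `g` itself leads back from `τ`
to `b`. -/
theorem ae_tendsto_sum_selected_div (h : IsGoodSelection a b) (ha : 0 < a)
    (ha1 : a < 1 / 14) (hT : MeasurePreserving T μ μ) (hS : MeasurePreserving S μ μ)
    (hTS : Function.Commute T S) (hf : Measurable f) (hg : Measurable g) {C : ℝ} (hC : 1 ≤ C)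
    (hf1 : ∀ x, ‖f x‖ ≤ C) (hg1 : ∀ x, ‖g x‖ ≤ C) :
    ∀ᵐ x ∂μ, Tendsto (fun N : ℕ => (∑ k ∈ Finset.range N,
      (b k : ℂ) * (f (T^[partialCount b k] x) * g (S^[k] x))) / (partialCount b N : ℂ)) atTop
      (𝓝 ((μ[f | MeasurableSpace.invariants T]) x * (μ[g | MeasurableSpace.invariants S]) x)) := by
  have hpos := selectionProb_pos a
  have hs := h.tendsto_partialCount_div_sum ha ha1
  have hsC : Tendsto (fun N : ℕ => (partialCount b N : ℂ) /
      ((∑ k ∈ Finset.range N, selectionProb a k : ℝ) : ℂ)) atTop (𝓝 1) := by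
    have := (Complex.continuous_ofReal.tendsto _).comp hs
    simpa [Function.comp_def] using this
  have hC0 : 0 < C := by linarith
  filter_upwards [ae_tendsto_sum_centered_div h ha ha1 hT hS hTS hf hg hC0 hf1 hg1,
    ae_tendsto_sum_centered_div (g := fun _ => 1) h ha ha1 hT hS hTS hf measurable_const hC0 hf1
      (fun _ => by simpa using hC),
    ae_tendsto_birkhoffSum_div_complex hT hf hf1, ae_exists_short_average hS hg hC0 hg1]
    with x h1 h2 h3 h4
  have h5 := (h3.comp (h.tendsto_partialCount ha ha1)).mul hsC
  have h6 := h5.sub h2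
  rw [mul_one, sub_zero] at h6
  have hF : Tendsto (fun N : ℕ => (∑ k ∈ Finset.range N,
      (selectionProb a k : ℂ) * f (T^[partialCount b k] x)) /
      ((∑ k ∈ Finset.range N, selectionProb a k : ℝ) : ℂ)) atTop
      (𝓝 ((μ[f | MeasurableSpace.invariants T]) x)) := by
    refine h6.congr' ?_
    filter_upwards [(h.tendsto_partialCount ha ha1).eventually_gt_atTop 0] with N hN
    have hN' : (partialCount b N : ℂ) ≠ 0 := by exact_mod_cast hN.ne'
    simp only [Function.comp_apply]
    rw [div_mul_div_cancel₀ hN', ← sub_div, ← sum_mul_partialCount_eq_birkhoffSum h.le_one,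
      ← Finset.sum_sub_distrib]
    congr 1
    refine Finset.sum_congr rfl fun k _ => ?_
    push_cast; ring
  have h7 := tendsto_sum_mul_of_short_averages h.le_one hpos (selectionProb_antitone ha.le)
    (tendsto_selectionProb ha) (tendsto_sum_selectionProb ha.le (by linarith)) hs
    (F := fun k => f (T^[partialCount b k] x)) (fun k => hf1 _)
    (fun k hk => by rw [partialCount_succ, hk, add_zero])
    (q := fun k => g (S^[k] x)) (fun k => hg1 _) hF h4
  have h8 := (h7.add h1).div hsC one_ne_zero
  rw [add_zero, div_one] at h8
  refine h8.congr' ?_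
  filter_upwards [eventually_gt_atTop 0] with N hN
  have hW : ((∑ k ∈ Finset.range N, selectionProb a k : ℝ) : ℂ) ≠ 0 := by
    exact_mod_cast (sum_range_pos_of_pos hpos hN).ne'
  simp only [Pi.div_apply]
  rw [← add_div, div_div_div_cancel_right₀ hW, ← Finset.sum_add_distrib]
  congr 1
  refine Finset.sum_congr rfl fun k _ => ?_
  push_cast; ring

/-- The Birkhoff sum of `f ∘ T` at `x` is that of `f` at `T x`, and the limit of the averages is
invariant. -/
theorem condExp_invariants_comp_ae_eq (hT : MeasurePreserving T μ μ) (hf : Measurable f) {C : ℝ}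
    (hf1 : ∀ x, ‖f x‖ ≤ C) :
    μ[f ∘ T | MeasurableSpace.invariants T] =ᵐ[μ] μ[f | MeasurableSpace.invariants T] := by
  filter_upwards [hT.quasiMeasurePreserving.ae (ae_tendsto_birkhoffSum_div_complex hT hf hf1),
    ae_tendsto_birkhoffSum_div_complex hT (hf.comp hT.measurable) (fun x => hf1 (T x))]
    with x h1 h2
  rw [condExp_invariants_comp_eq] at h1
  refine tendsto_nhds_unique h2 (h1.congr fun n => ?_)
  congr 1
  refine Finset.sum_congr rfl fun k _ => ?_
  rw [Function.comp_apply, ← Function.iterate_succ_apply, ← Function.iterate_succ_apply' T]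

theorem tendsto_average_of_bounded (hT : MeasurePreserving T μ μ) (hf : Measurable f) {C : ℝ}
    (hf1 : ∀ x, ‖f x‖ ≤ C) :
    ∀ᵐ x ∂μ, Tendsto (fun N : ℕ => (1 / (N : ℂ)) * ∑ n ∈ Finset.Icc 1 N, f (T^[n] x)) atTop
      (𝓝 ((μ[f | MeasurableSpace.invariants T]) x)) := by
  filter_upwards [hT.quasiMeasurePreserving.ae (ae_tendsto_birkhoffSum_div_complex hT hf hf1)]
    with x hx
  rw [condExp_invariants_comp_eq] at hx
  refine hx.congr fun N => ?_
  rw [one_div, inv_mul_eq_div, birkhoffSum_apply_eq_sum_Icc]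

end System

/-! ### From the indicator sequence back to the increasing enumeration -/

section Selection

variable {Ω : Type*} {X : ℕ → Ω → ℝ} {ω : Ω}

open Classical in
/-- The indicator sequence of the selected integers, indexed from `0`. -/
noncomputable def selectionIndicator (X : ℕ → Ω → ℝ) (k : ℕ) (ω : Ω) : ℕ :=
  if X (k + 1) ω = 1 then 1 else 0

theorem selectionIndicator_le_one (X : ℕ → Ω → ℝ) (k : ℕ) (ω : Ω) :
    selectionIndicator X k ω ≤ 1 := by
  unfold selectionIndicator; split_ifs <;> simp

theorem selectionIndicator_eq_one_iff {k : ℕ} : selectionIndicator X k ω = 1 ↔ X (k + 1) ω = 1 := by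
  unfold selectionIndicator; split_ifs <;> simp_all

/-- Two shifts meet: index `k` stands for the integer `k + 1`, and `randomSeq` counts from `1`. The
number of selected integers below `k + 1` is the partial count at `k`. -/
theorem randomSeq_partialCount_add_one {k : ℕ} (hk : selectionIndicator X k ω = 1) :
    randomSeq X ω (partialCount (fun i => selectionIndicator X i ω) k + 1) = k + 1 := by
  classical
  have hcount : ∀ k, Nat.count (fun i => i ∈ selected X ω) (k + 1)
      = partialCount (fun i => selectionIndicator X i ω) k := by
    intro k
    induction k with
    | zero => simp [partialCount, Nat.count_succ, selected]
    | succ k ih =>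
      rw [Nat.count_succ, ih, partialCount_succ]
      simp [selected, selectionIndicator]
  have hmem : k + 1 ∈ selected X ω := ⟨by omega, selectionIndicator_eq_one_iff.1 hk⟩
  unfold randomSeq
  rw [Nat.add_sub_cancel, ← hcount]
  exact Nat.nth_count (p := fun i => i ∈ selected X ω) hmem

theorem sum_selectionIndicator_eq_sum_randomSeq (Φ : ℕ → ℕ → ℂ) (K : ℕ) :
    ∑ k ∈ Finset.range K, (selectionIndicator X k ω : ℂ) *
        Φ (partialCount (fun i => selectionIndicator X i ω) k + 1) (k + 1)
      = ∑ n ∈ Finset.Icc 1 (partialCount (fun i => selectionIndicator X i ω) K),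
          Φ n (randomSeq X ω n) := by
  induction K with
  | zero => simp [partialCount]
  | succ K ih =>
    rw [Finset.sum_range_succ, ih, partialCount_succ]
    have := selectionIndicator_le_one X K ω
    rcases (show selectionIndicator X K ω = 0 ∨ selectionIndicator X K ω = 1 by omega) with h | h
    · simp [h]
    · rw [h, Finset.sum_Icc_succ_top (by omega), randomSeq_partialCount_add_one h]
      simp

theorem infinite_selected_of_tendsto
    (h : Tendsto (partialCount fun i => selectionIndicator X i ω) atTop atTop) :
    (selected X ω).Infinite := by
  refine Set.infinite_of_forall_exists_gt fun m => ?_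
  obtain ⟨K, hK⟩ := (h.eventually_gt_atTop
    (partialCount (fun i => selectionIndicator X i ω) m)).and (eventually_ge_atTop m) |>.exists
  by_contra! hcon
  have hz : ∑ k ∈ Finset.Ico m K, selectionIndicator X k ω = 0 := by
    refine Finset.sum_eq_zero fun k hk => ?_
    have h1 := selectionIndicator_le_one X k ω
    by_contra hne
    have := hcon (k + 1)
      ⟨by omega, selectionIndicator_eq_one_iff.1 (show selectionIndicator X k ω = 1 by omega)⟩
    have := (Finset.mem_Ico.1 hk).1
    omega
  have := Finset.sum_range_add_sum_Ico (fun k => selectionIndicator X k ω) hK.2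
  have h2 := hK.1
  simp only [partialCount] at h2
  omega

/-- The count rises in steps of at most one, so no value is skipped. -/
theorem exists_partialCount_eq {b : ℕ → ℕ} (hb : ∀ k, b k ≤ 1)
    (h : Tendsto (partialCount b) atTop atTop) (N : ℕ) : ∃ K, partialCount b K = N := by
  classical
  have hex : ∃ K, N ≤ partialCount b K := (h.eventually_ge_atTop N).exists
  refine ⟨Nat.find hex, le_antisymm ?_ (Nat.find_spec hex)⟩
  rcases hK : Nat.find hex with _ | K
  · simp [partialCount]
  · have h1 : partialCount b K < N := not_le.1 (Nat.find_min hex (by omega))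
    have := hb K
    rw [partialCount_succ]
    omega

/-- The `N`-th average is read off at an index `K N ≥ N` where the count equals `N`. Applying the
previous results to `f ∘ T` and `g ∘ S` absorbs both shifts by one. -/
theorem ae_tendsto_average_randomSeq {a : ℝ}
    (h : IsGoodSelection a fun k => selectionIndicator X k ω) (ha : 0 < a) (ha1 : a < 1 / 14)
    {Y : Type*} [MeasurableSpace Y] {μ : Measure Y} [IsProbabilityMeasure μ] {T S : Y → Y}
    (hT : MeasurePreserving T μ μ) (hS : MeasurePreserving S μ μ) (hTS : Function.Commute T S)
    {f g : Y → ℂ} (hf : Measurable f) (hg : Measurable g) {C : ℝ}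
    (hf1 : ∀ x, ‖f x‖ ≤ C) (hg1 : ∀ x, ‖g x‖ ≤ C) :
    ∀ᵐ x ∂μ, Tendsto (fun N : ℕ => (1 / (N : ℂ)) *
        ∑ n ∈ Finset.Icc 1 N, f (T^[n] x) * g (S^[randomSeq X ω n] x)) atTop
      (𝓝 ((μ[f | MeasurableSpace.invariants T]) x *
        (μ[g | MeasurableSpace.invariants S]) x)) := by
  have htop := h.tendsto_partialCount ha ha1
  choose K hK using exists_partialCount_eq h.le_one htop
  have hKtop : Tendsto K atTop atTop := tendsto_atTop_mono (fun N => by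
    have := partialCount_le h.le_one (K N)
    rwa [hK] at this) tendsto_id
  filter_upwards [ae_tendsto_sum_selected_div h ha ha1 hT hS hTS (hf.comp hT.measurable)
    (hg.comp hS.measurable) (le_max_right C 1) (fun x => (hf1 _).trans (le_max_left _ _))
    (fun x => (hg1 _).trans (le_max_left _ _)), condExp_invariants_comp_ae_eq hT hf hf1,
    condExp_invariants_comp_ae_eq hS hg hg1] with x hx h1 h2
  rw [h1, h2] at hx
  refine (hx.comp hKtop).congr fun N => ?_
  have := sum_selectionIndicator_eq_sum_randomSeq (X := X) (ω := ω)
    (fun n m => f (T^[n] x) * g (S^[m] x)) (K N)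
  simp only [Function.comp_apply, hK, Function.iterate_succ_apply'] at this ⊢
  rw [this, one_div, inv_mul_eq_div]

end Selection

theorem ae_isGoodSelection {Ω : Type*} [MeasurableSpace Ω] {P : Measure Ω} [IsProbabilityMeasure P]
    {a : ℝ} {X : ℕ → Ω → ℝ} (hX_meas : ∀ n : ℕ, 1 ≤ n → Measurable (X n))
    (hX_indep : iIndepFun (fun n : ℕ => X (n + 1)) P)
    (hX_one : ∀ n : ℕ, 1 ≤ n → P.real {ω | X n ω = 1} = (n : ℝ) ^ (-a)) :
    ∀ᵐ ω ∂P, IsGoodSelection a fun k => selectionIndicator X k ω := by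
  classical
  have hφ : Measurable fun r : ℝ => if r = 1 then (1 : ℕ) else 0 :=
    Measurable.ite (measurableSet_singleton 1) measurable_const measurable_const
  have hb : ∀ k, selectionIndicator X k = (fun r : ℝ => if r = 1 then (1 : ℕ) else 0) ∘ X (k + 1) :=
    fun k => by ext ω; simp [selectionIndicator]
  have hind : iIndepFun (selectionIndicator X) P := by
    have := hX_indep.comp (fun _ r => if r = 1 then (1 : ℕ) else 0) fun _ => hφ
    rwa [← funext hb] at this
  have hbm : ∀ k, Measurable (selectionIndicator X k) := fun k => by
    rw [hb]; exact hφ.comp (hX_meas (k + 1) (by omega))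
  have hprob : ∀ k, P.real {ω | selectionIndicator X k ω = 1} = selectionProb a k := fun k => by
    simp_rw [selectionIndicator_eq_one_iff]
    rw [hX_one (k + 1) (by omega), selectionProb]
    push_cast; rfl
  filter_upwards [ae_eventually_correlationBound hbm hind (selectionIndicator_le_one X) hprob]
    with ω hω
  exact ⟨fun k => selectionIndicator_le_one X k ω, hω⟩

theorem theorem1p1 {Ω : Type u} [MeasurableSpace Ω] (P : Measure Ω) [IsProbabilityMeasure P]
    (a : ℝ) (ha_pos : 0 < a) (ha_lt : a < 1 / 14)
    (X : ℕ → Ω → ℝ) (hX_meas : ∀ n : ℕ, 1 ≤ n → Measurable (X n))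
    (hX_indep : iIndepFun (fun n : ℕ => X (n + 1)) P)
    (hX_one : ∀ n : ℕ, 1 ≤ n → P.real {ω | X n ω = 1} = (n : ℝ) ^ (-a))
    (hX_zero : ∀ n : ℕ, 1 ≤ n → P.real {ω | X n ω = 0} = 1 - (n : ℝ) ^ (-a)) :
    ∀ᵐ ω ∂P, (selected X ω).Infinite ∧
      ∀ (Y : Type v) [MeasurableSpace Y] (μ : Measure Y) [IsProbabilityMeasure μ]
        (T S : Y → Y), MeasurePreserving T μ μ → MeasurePreserving S μ μ →
        Function.Commute T S →
        ∀ f g : Y → ℂ, MemLp f ⊤ μ → MemLp g ⊤ μ →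
          ∀ᵐ x ∂μ,
            Tendsto (fun N : ℕ => (1 / (N : ℂ)) * ∑ n ∈ Finset.Icc 1 N, f (T^[n] x)) atTop
              (𝓝 ((μ[f | MeasurableSpace.invariants T]) x)) ∧
            Tendsto (fun N : ℕ => (1 / (N : ℂ)) * ∑ n ∈ Finset.Icc 1 N, g (S^[n] x)) atTop
              (𝓝 ((μ[g | MeasurableSpace.invariants S]) x)) ∧
            Tendsto (fun N : ℕ => (1 / (N : ℂ)) *
                ∑ n ∈ Finset.Icc 1 N, f (T^[n] x) * g (S^[randomSeq X ω n] x)) atTop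
              (𝓝 ((μ[f | MeasurableSpace.invariants T]) x *
                (μ[g | MeasurableSpace.invariants S]) x)) := by
  -- Goodness concerns the selection alone, so `ω` is fixed before any system is introduced.
  filter_upwards [ae_isGoodSelection hX_meas hX_indep hX_one] with ω hω
  refine ⟨infinite_selected_of_tendsto (hω.tendsto_partialCount ha_pos ha_lt), ?_⟩
  intro Y _ μ _ T S hT hS hTS f g hf hg
  obtain ⟨f', hf'm, hff', C₁, hC₁⟩ := exists_measurable_bounded_ae_eq hf
  obtain ⟨g', hg'm, hgg', C₂, hC₂⟩ := exists_measurable_bounded_ae_eq hg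
  have hfT : ∀ᵐ x ∂μ, ∀ n, f (T^[n] x) = f' (T^[n] x) :=
    ae_all_iff.2 fun n => (hT.iterate n).quasiMeasurePreserving.ae hff'
  have hgS : ∀ᵐ x ∂μ, ∀ n, g (S^[n] x) = g' (S^[n] x) :=
    ae_all_iff.2 fun n => (hS.iterate n).quasiMeasurePreserving.ae hgg'
  filter_upwards [hfT, hgS, condExp_congr_ae (m := MeasurableSpace.invariants T) hff',
    condExp_congr_ae (m := MeasurableSpace.invariants S) hgg',
    tendsto_average_of_bounded hT hf'm hC₁, tendsto_average_of_bounded hS hg'm hC₂,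
    ae_tendsto_average_randomSeq hω ha_pos ha_lt hT hS hTS hf'm hg'm
      (fun x => (hC₁ x).trans (le_max_left C₁ C₂)) (fun x => (hC₂ x).trans (le_max_right C₁ C₂))]
    with x h1 h2 h3 h4 h5 h6 h7
  simp only [h1, h2, h3, h4]
  exact ⟨h5, h6, h7⟩
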